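/- **Proposition 2.4.** Let $\mathfrak g$ be a finite-dimensional complex semisimple Lie algebra with Dynkin diagram on the vertex set $I$ and Cartan matrix $A=(a_{ij})_{i,j\in I}$, and suppose that $\mathfrak g$ is simply laced ($a_{ij}\in\{0,-1\}$ for $i\ne j$). Let $\sigma:I\to I$ be an admissible diagram automorphism, that is, a bijection with $a_{\sigma(i),\sigma(j)}=a_{ij}$ for all $i,j\in I$ and $a_{i,\sigma^k(i)}=0$ whenever $k\in\mathbb Z$ and $\sigma^k(i)\neq i$. For $r\in I/\sigma$ let $\mathcal O_r\subset I$ be the corresponding $\sigma$-orbit. Let ${\mathfrak g^\sigma}^\vee$ be the semisimple Lie algebra with Cartan matrix $(A')^T$, where $A'=(a'_{r,s})_{r,s\in I/\sigma}$, $a'_{r,s}=\sum_{i\in\mathcal O_r}a_{ij}$ for any $j\in\mathcal O_s$, is the Cartan matrix of the fixed Lie subalgebra $\mathfrak g^\sigma$. For a semisimple Lie algebra $\mathfrak k$ with Cartan matrix $(c_{ij})_{i,j\in J}$, let $W(\mathfrak k)$ be the Weyl group, generated by the simple reflections $s_i(\alpha_j)=\alpha_j-c_{ij}\alpha_i$ of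 the root lattice $\bigoplus_{j\in J}\mathbb Z\alpha_j$. Let $Br_{\mathfrak k}$ be the Artin braid group, with generators $T_i$ ($i\in J$) and relations $T_iT_jT_i\cdots=T_jT_iT_j\cdots$ ($m_{ij}$ factors on each side), where, for $i\neq j$, $m_{ij}=2,3,4,6$ according to $c_{ij}c_{ji}=0,1,2,3$. For $w\in W(\mathfrak k)$ put $T_w=T_{i_1}\cdots T_{i_m}$ for any reduced decomposition $w=s_{i_1}\cdots s_{i_m}$; this does not depend on the decomposition. The map $\sigma$ acts on $W(\mathfrak g)$ by $s_i\mapsto s_{\sigma(i)}$ and on $Br_{\mathfrak g}$ by $T_i\mapsto T_{\sigma(i)}$; a superscript $\sigma$ denotes the subgroup of fixed points. Then: 1. The assignment $s_r\mapsto \hat s_r=\prod_{i\in\mathcal O_r}s_i$, $r\in I/\sigma$, extends to an isomorphism of groups $W({\mathfrak g^\sigma}^\vee)\to W(\mathfrak g)^\sigma$, $w\mapsto\hat w$. 2. The assignment $T_r\mapsto \hat T_r=\prod_{i\in\mathcal O_r}T_i$, $r\in I/\sigma$, extends to an isomorphism of groups $Br_{{\mathfrak g^\sigma}^\vee}\to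 (Br_{\mathfrak g})^\sigma$. Under this isomorphism the element $T_w$ is mapped to $T_{\hat w}$, for every $w\in W({\mathfrak g^\sigma}^\vee)$. (The factors of $\hat s_r$, and those of $\hat T_r$, commute, so the products are well defined.) -/

import Mathlib

/-- A Cartan matrix of a (finite-dimensional) semisimple Lie algebra: `2` on the diagonal,
non-positive integers off the diagonal, and positive definite after multiplication by a diagonal
matrix of positive integers that makes it symmetric. -/
structure FiniteCartan (ι : Type*) [Fintype ι] where
  /-- The matrix `(a i j)`. -/
  A : Matrix ι ι ℤ
  diag : ∀ i, A i i = 2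
  nonpos : ∀ i j, i ≠ j → A i j ≤ 0
  posDef : ∃ d : ι → ℤ, (∀ i, 0 < d i) ∧ (∀ i j, d i * A i j = d j * A j i) ∧
    ∀ x : ι → ℤ, x ≠ 0 → 0 < ∑ i, ∑ j, x i * (d i * A i j) * x j

namespace FiniteCartan

/-- The Cartan matrix of a complex semisimple Lie algebra `𝔤` with Cartan subalgebra `H` and base
`b` of its root system (the vertices of the Dynkin diagram), in the convention
`a i j = α_j (α_i^∨)`, that is `[h_i, e_j] = a i j • e_j`. Mathlib's `cartanMatrix` is
`α_i (α_j^∨)`, hence the transpose. -/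
noncomputable def ofBase {𝔤 : Type*} [LieRing 𝔤] [LieAlgebra ℂ 𝔤] [FiniteDimensional ℂ 𝔤]
    [LieAlgebra.IsSemisimple ℂ 𝔤] {H : LieSubalgebra ℂ 𝔤} [H.IsCartanSubalgebra]
    (b : (LieAlgebra.IsKilling.rootSystem H).Base) : FiniteCartan b.support where
  A := b.cartanMatrix.transpose
  diag i := b.cartanMatrix_apply_same i
  nonpos i j h := b.cartanMatrix_le_zero_of_ne j i h.symm
  posDef := by
    classical
    obtain ⟨d, hd, hp⟩ := b.exists_cartanMatrix_mul_diagaonal_posDef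
    have hs : ∀ i j, d i * b.cartanMatrix j i = d j * b.cartanMatrix i j := fun i j => by
      have h := hp.1.apply i j
      simp only [Matrix.mul_diagonal, star_trivial] at h
      linarith
    refine ⟨d, hd, hs, fun x hx => ?_⟩
    have h := hp.dotProduct_mulVec_pos hx
    simp only [dotProduct, Matrix.mulVec, Matrix.mul_diagonal, star_trivial,
      Finset.mul_sum] at h
    refine h.trans_eq (Finset.sum_congr rfl fun i _ => Finset.sum_congr rfl fun j _ => ?_)
    rw [Matrix.transpose_apply, hs]
    ring

variable {ι : Type*} [Fintype ι] (C : FiniteCartan ι)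

theorem zero_symm {i j : ι} (h : C.A i j = 0) : C.A j i = 0 := by
  obtain ⟨d, hd, hs, -⟩ := C.posDef
  have := hs i j
  rw [h, mul_zero] at this
  exact (mul_eq_zero.1 this.symm).resolve_left (hd j).ne'

theorem isSymm_of_simplyLaced (h : C.A.IsSimplyLaced) (i j : ι) : C.A i j = C.A j i := by
  rcases eq_or_ne i j with rfl | hij
  · rfl
  rcases h hij with h1 | h1 <;> rcases h hij.symm with h2 | h2
  · rw [h1, h2]
  · rw [C.zero_symm h1, h1]
  · rw [C.zero_symm h2, h2]
  · rw [h1, h2]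

/-! ### The Weyl group -/

/-- The reflection `s_i (α_j) = α_j - a i j • α_i` of the root lattice `⨁ i, ℤ α_i`. -/
noncomputable def reflection (i : ι) : (ι →₀ ℤ) ≃ₗ[ℤ] (ι →₀ ℤ) :=
  Module.reflection (x := Finsupp.single i 1) (f := Finsupp.linearCombination ℤ (C.A i))
    (by simp [C.diag])

theorem reflection_single (i j : ι) :
    C.reflection i (Finsupp.single j 1) = Finsupp.single j 1 - C.A i j • Finsupp.single i 1 := by
  simp [reflection, Module.reflection_apply]

/-- The Weyl group, generated by the simple reflections of the root lattice. -/
noncomputable def weyl : Subgroup ((ι →₀ ℤ) ≃ₗ[ℤ] (ι →₀ ℤ)) := Subgroup.closure (Set.range C.reflection)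

/-- The simple reflection `s_i` as an element of the Weyl group. -/
noncomputable def s (i : ι) : C.weyl := ⟨C.reflection i, Subgroup.subset_closure ⟨i, rfl⟩⟩

/-- `l ∈ R(w)`: the word `l` is a reduced decomposition of `w`. -/
def IsReducedWord (w : C.weyl) (l : List ι) : Prop :=
  (l.map C.s).prod = w ∧ ∀ l' : List ι, (l'.map C.s).prod = w → l.length ≤ l'.length

theorem reflection_mul_self (i : ι) : C.reflection i * C.reflection i = 1 := by
  apply LinearEquiv.toLinearMap_injective
  ext1 k
  ext1
  change C.reflection i (C.reflection i (Finsupp.single k 1)) = Finsupp.single k 1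
  rw [reflection_single, map_sub, map_zsmul, reflection_single, reflection_single, C.diag]
  module

/-- The set `R(w)` is never empty. -/
theorem exists_isReducedWord (w : C.weyl) : ∃ l, C.IsReducedWord w l := by
  classical
  have hex : ∃ n, ∃ l : List ι, (l.map C.s).prod = w ∧ l.length = n := by
    obtain ⟨w, hw⟩ := w
    have hs : ∀ i, (C.s i)⁻¹ = C.s i := fun i =>
      inv_eq_of_mul_eq_one_left (Subtype.ext (C.reflection_mul_self i))
    suffices ∃ l : List ι, (l.map C.s).prod = ⟨w, hw⟩ from
      let ⟨l, hl⟩ := this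
      ⟨_, l, hl, rfl⟩
    induction hw using Subgroup.closure_induction with
    | mem x hx => obtain ⟨i, rfl⟩ := hx; exact ⟨[i], by simp; rfl⟩
    | one => exact ⟨[], rfl⟩
    | mul x y hx hy h1 h2 =>
      obtain ⟨l1, h1⟩ := h1
      obtain ⟨l2, h2⟩ := h2
      exact ⟨l1 ++ l2, by rw [List.map_append, List.prod_append, h1, h2]; rfl⟩
    | inv x hx h1 =>
      obtain ⟨l1, h1⟩ := h1
      refine ⟨l1.reverse, ?_⟩
      have h2 := congrArg Inv.inv h1
      rw [List.prod_inv_reverse, List.map_map] at h2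
      rw [List.map_reverse]
      exact (congrArg (fun f => (l1.map f).reverse.prod) (funext fun i => (hs i).symm)).trans h2
  obtain ⟨l, hl, hn⟩ := Nat.find_spec hex
  exact ⟨l, hl, fun l' hl' => hn ▸ Nat.find_min' hex ⟨l', hl', rfl⟩⟩

/-! ### The braid group -/

/-- The exponent `m i j` of the Coxeter relation (for a finite type Cartan matrix and `i ≠ j`,
the product `a i j * a j i` is one of `0, 1, 2, 3`). -/
noncomputable def m (i j : ι) : ℕ :=
  open Classical in
  if i = j then 1
  else if C.A i j * C.A j i = 0 then 2
  else if C.A i j * C.A j i = 1 then 3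
  else if C.A i j * C.A j i = 2 then 4
  else 6

/-- The alternating product `x y x ⋯` with `n` factors. -/
def alt {G : Type*} [Monoid G] (x y : G) : ℕ → G
  | 0 => 1
  | n + 1 => x * alt y x n

theorem map_alt {G G' : Type*} [Monoid G] [Monoid G'] (f : G →* G') (n : ℕ) :
    ∀ x y : G, f (alt x y n) = alt (f x) (f y) n := by
  induction n with
  | zero => intro x y; simp [alt]
  | succ n ih => intro x y; simp [alt, ih]

/-- The braid relations `T_i T_j ⋯ = T_j T_i ⋯` (`m i j` factors on both sides). -/
noncomputable def braidRels : Set (FreeGroup ι) :=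
  Set.range fun p : ι × ι => alt (FreeGroup.of p.1) (FreeGroup.of p.2) (C.m p.1 p.2) *
    (alt (FreeGroup.of p.2) (FreeGroup.of p.1) (C.m p.1 p.2))⁻¹

/-- The Artin braid group. -/
abbrev Braid : Type _ := PresentedGroup C.braidRels

/-- The generator `T_i` of the braid group. -/
noncomputable def T (i : ι) : C.Braid := PresentedGroup.of i

theorem braid_relation (i j : ι) :
    alt (C.T i) (C.T j) (C.m i j) = alt (C.T j) (C.T i) (C.m i j) := by
  have h := PresentedGroup.mk_eq_mk_of_mul_inv_mem (rels := C.braidRels) ⟨(i, j), rfl⟩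
  rw [map_alt, map_alt] at h
  exact h

end FiniteCartan

/-! ### Diagram automorphisms and orbits -/

/-- The index set `I / σ` of orbits of the cyclic group generated by `σ`. -/
def Orbits {ι : Type*} (σ : Equiv.Perm ι) : Type _ := Quotient (Equiv.Perm.SameCycle.setoid σ)

namespace Orbits

variable {ι : Type*} (σ : Equiv.Perm ι)

/-- The class of `i`. -/
def mk (i : ι) : Orbits σ := Quotient.mk _ i

/-- A representative of the orbit `r`. -/
noncomputable def rep (r : Orbits σ) : ι := Quotient.out r

variable {σ}

theorem mk_rep (r : Orbits σ) : mk σ (rep σ r) = r := Quotient.out_eq r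

theorem mk_eq_iff {i j : ι} : mk σ i = mk σ j ↔ ∃ k : ℤ, (σ ^ k) i = j :=
  ⟨fun h => Quotient.exact h, fun h => Quotient.sound h⟩

theorem mk_apply (i : ι) : mk σ (σ i) = mk σ i := (mk_eq_iff.2 ⟨1, by simp⟩).symm

noncomputable instance [Fintype ι] : Fintype (Orbits σ) := by
  classical exact Fintype.ofSurjective (mk σ) fun r => ⟨rep σ r, mk_rep r⟩

variable (σ) in
open Classical in
/-- The orbit `O_r ⊆ I`. -/
noncomputable def toFinset [Fintype ι] (r : Orbits σ) : Finset ι :=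
  Finset.univ.filter fun i => mk σ i = r

@[simp] theorem mem_toFinset [Fintype ι] {r : Orbits σ} {i : ι} :
    i ∈ toFinset σ r ↔ mk σ i = r := by
  simp [toFinset]

theorem sum_eq [Fintype ι] (f : ι → ℤ) :
    ∑ i, f i = ∑ r : Orbits σ, ∑ i ∈ toFinset σ r, f i := by
  classical
  rw [← Finset.sum_fiberwise Finset.univ (mk σ)]
  exact Finset.sum_congr rfl fun r _ => Finset.sum_congr (by ext; simp) fun _ _ => rfl

end Orbits

namespace FiniteCartan

variable {ι : Type*} [Fintype ι] (C : FiniteCartan ι)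

/-- `σ` is an admissible diagram automorphism: it preserves the Cartan matrix, and distinct
vertices of the same orbit are not joined in the Dynkin diagram. -/
structure IsAdmissible (σ : Equiv.Perm ι) : Prop where
  map_eq : ∀ i j, C.A (σ i) (σ j) = C.A i j
  admissible : ∀ (i : ι) (k : ℤ), (σ ^ k) i ≠ i → C.A i ((σ ^ k) i) = 0

variable {C} {σ : Equiv.Perm ι}

theorem IsAdmissible.eq_zero (hσ : C.IsAdmissible σ) {i j : ι}
    (h : Orbits.mk σ i = Orbits.mk σ j) (hij : i ≠ j) : C.A i j = 0 := by
  obtain ⟨k, rfl⟩ := Orbits.mk_eq_iff.1 h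
  exact hσ.admissible i k hij.symm

theorem IsAdmissible.zpow_map_eq (hσ : C.IsAdmissible σ) (k : ℤ) (i j : ι) :
    C.A ((σ ^ k) i) ((σ ^ k) j) = C.A i j := by
  induction k using Int.induction_on generalizing i j with
  | zero => simp
  | succ n ih => rw [zpow_add_one, Equiv.Perm.mul_apply, Equiv.Perm.mul_apply, ih, hσ.map_eq]
  | pred n ih =>
    rw [zpow_sub_one, Equiv.Perm.mul_apply, Equiv.Perm.mul_apply, ih, ← hσ.map_eq]
    simp

variable (C σ) in
/-- The matrix `a' r s = ∑ i ∈ O_r, a i j`, for any `j ∈ O_s`: the Cartan matrix of the Lie algebra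
`𝔤^σ` of fixed points, with respect to its Chevalley generators `∑ i ∈ O_r, e_i` and
`∑ i ∈ O_r, f_i`. -/
noncomputable def foldedMatrix : Matrix (Orbits σ) (Orbits σ) ℤ :=
  fun r s => ∑ i ∈ Orbits.toFinset σ r, C.A i (Orbits.rep σ s)

theorem foldedMatrix_apply (hσ : C.IsAdmissible σ) (r : Orbits σ) (j : ι) :
    C.foldedMatrix σ r (Orbits.mk σ j) = ∑ i ∈ Orbits.toFinset σ r, C.A i j := by
  obtain ⟨k, hk⟩ := Orbits.mk_eq_iff.1 (Orbits.mk_rep (Orbits.mk σ j))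
  have hmk : ∀ i, Orbits.mk σ ((σ ^ k) i) = Orbits.mk σ i :=
    fun i => (Orbits.mk_eq_iff.2 ⟨k, rfl⟩).symm
  refine Finset.sum_equiv (σ ^ k) (fun i => by simp [hmk]) fun i _ => ?_
  conv_rhs => rw [← hk]
  exact (hσ.zpow_map_eq k _ _).symm

/-- The Cartan matrix of `(𝔤^σ)^∨`, the Langlands dual of the Lie algebra of fixed points of an
admissible diagram automorphism `σ` of a simply laced semisimple Lie algebra `𝔤`: the transpose of
the Cartan matrix of `𝔤^σ`. -/
noncomputable def dualFold (hC : C.A.IsSimplyLaced) (hσ : C.IsAdmissible σ) :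
    FiniteCartan (Orbits σ) where
  A := (C.foldedMatrix σ).transpose
  diag r := by
    rw [Matrix.transpose_apply, foldedMatrix, Finset.sum_eq_single (Orbits.rep σ r), C.diag]
    · intro i hi h
      exact hσ.eq_zero (by rw [Orbits.mem_toFinset.1 hi, Orbits.mk_rep]) h
    · intro h
      exact absurd (Orbits.mem_toFinset.2 (Orbits.mk_rep r)) h
  nonpos r s h := by
    refine Finset.sum_nonpos fun i hi => C.nonpos _ _ ?_
    rintro rfl
    rw [Orbits.mem_toFinset, Orbits.mk_rep] at hi
    exact h hi
  posDef := by
    classical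
    obtain ⟨d, hd, hs, hp⟩ := C.posDef
    set d' : Orbits σ → ℤ := fun r => ∑ j ∈ Orbits.toFinset σ r, d j with hd'
    have key : ∀ r s, d' r * (C.foldedMatrix σ).transpose r s =
        ∑ j ∈ Orbits.toFinset σ r, ∑ i ∈ Orbits.toFinset σ s, d j * C.A j i := fun r s => by
      rw [hd', Finset.sum_mul]
      refine Finset.sum_congr rfl fun j hj => ?_
      rw [← Orbits.mem_toFinset.1 hj, Matrix.transpose_apply, foldedMatrix_apply hσ,
        Finset.mul_sum]
      exact Finset.sum_congr rfl fun i _ => by rw [C.isSymm_of_simplyLaced hC]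
    refine ⟨d', fun r => ?_, fun r s => ?_, fun x hx => ?_⟩
    · exact Finset.sum_pos (fun i _ => hd i) ⟨_, Orbits.mem_toFinset.2 (Orbits.mk_rep r)⟩
    · rw [key, key, Finset.sum_comm]
      exact Finset.sum_congr rfl fun i _ => Finset.sum_congr rfl fun j _ => hs j i
    · have h := hp (fun i => x (Orbits.mk σ i)) fun h => hx (funext fun r => by
        rw [← Orbits.mk_rep r]; exact congrFun h _)
      refine h.trans_eq ?_
      rw [Orbits.sum_eq]
      refine Finset.sum_congr rfl fun r _ => ?_
      simp_rw [key, Finset.mul_sum, Finset.sum_mul]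
      conv_rhs => rw [Finset.sum_comm]
      refine Finset.sum_congr rfl fun j hj => ?_
      rw [Orbits.sum_eq]
      refine Finset.sum_congr rfl fun s _ => Finset.sum_congr rfl fun i hi => ?_
      rw [Orbits.mem_toFinset.1 hj, Orbits.mem_toFinset.1 hi]

/-! ### The action of `σ` on the Weyl group and the braid group -/

/-- The permutation `α_i ↦ α_{σ i}` of the root lattice. -/
noncomputable def latticePerm {ι : Type*} (σ : Equiv.Perm ι) : (ι →₀ ℤ) ≃ₗ[ℤ] (ι →₀ ℤ) :=
  Finsupp.domLCongr σ

theorem latticePerm_single {ι : Type*} (σ : Equiv.Perm ι) (i : ι) :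
    latticePerm σ (Finsupp.single i 1) = Finsupp.single (σ i) 1 := by
  simp [latticePerm]

theorem latticePerm_symm_single {ι : Type*} (σ : Equiv.Perm ι) (i : ι) :
    (latticePerm σ).symm (Finsupp.single i 1) = Finsupp.single (σ.symm i) 1 := by
  rw [LinearEquiv.symm_apply_eq, latticePerm_single, Equiv.apply_symm_apply]

/-- The subgroup of fixed points of an automorphism of a group. -/
def fixedSubgroup {G : Type*} [Group G] (φ : G ≃* G) : Subgroup G :=
  φ.toMonoidHom.eqLocus (MonoidHom.id G)

theorem conj_reflection (hσ : C.IsAdmissible σ) (i : ι) :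
    MulAut.conj (latticePerm σ) (C.reflection i) =
      C.reflection (σ i) := by
  apply LinearEquiv.toLinearMap_injective
  ext1 j
  ext1
  change latticePerm σ (C.reflection i ((latticePerm σ).symm (Finsupp.single j 1))) =
    C.reflection (σ i) (Finsupp.single j 1)
  rw [latticePerm_symm_single, reflection_single, reflection_single, map_sub, map_zsmul,
    latticePerm_single, latticePerm_single, ← hσ.map_eq, Equiv.apply_symm_apply]

theorem map_conj_weyl (hσ : C.IsAdmissible σ) :
    C.weyl.map (MulAut.conj (latticePerm σ)).toMonoidHom = C.weyl := by
  rw [weyl, MonoidHom.map_closure, ← Set.range_comp]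
  congr 1
  have : ((MulAut.conj (latticePerm σ)).toMonoidHom :
      _ → _) ∘ C.reflection = C.reflection ∘ σ := funext fun i => conj_reflection hσ i
  rw [this, σ.surjective.range_comp]

/-- The automorphism of the Weyl group with `s_i ↦ s_{σ i}`. -/
noncomputable def weylAut (hσ : C.IsAdmissible σ) : C.weyl ≃* C.weyl :=
  ((MulAut.conj (latticePerm σ)).subgroupMap C.weyl).trans
    (MulEquiv.subgroupCongr (map_conj_weyl hσ))

theorem weylAut_s (hσ : C.IsAdmissible σ) (i : ι) : weylAut hσ (C.s i) = C.s (σ i) :=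
  Subtype.ext (conj_reflection hσ i)

theorem m_map (hσ : C.IsAdmissible σ) (i j : ι) : C.m (σ i) (σ j) = C.m i j := by
  by_cases h : i = j <;> simp [m, hσ.map_eq, h]

theorem IsAdmissible.symm (hσ : C.IsAdmissible σ) : C.IsAdmissible σ.symm where
  map_eq i j := by rw [← hσ.map_eq]; simp
  admissible i k h := by
    have e : σ.symm ^ k = σ ^ (-k) := by rw [zpow_neg, ← inv_zpow]; rfl
    rw [e] at h ⊢
    exact hσ.admissible i _ h

/-- The endomorphism of the braid group with `T_i ↦ T_{σ i}`. -/
noncomputable def braidHom (hσ : C.IsAdmissible σ) : C.Braid →* C.Braid :=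
  PresentedGroup.toGroup (f := fun i => C.T (σ i)) (by
    rintro _ ⟨⟨i, j⟩, rfl⟩
    rw [map_mul, map_inv, map_alt, map_alt, mul_inv_eq_one, FreeGroup.lift_apply_of,
      FreeGroup.lift_apply_of]
    change alt (C.T (σ i)) (C.T (σ j)) (C.m i j) = alt (C.T (σ j)) (C.T (σ i)) (C.m i j)
    rw [← m_map hσ, braid_relation])

theorem braidHom_T (hσ : C.IsAdmissible σ) (i : ι) : braidHom hσ (C.T i) = C.T (σ i) :=
  PresentedGroup.toGroup.of _

/-- The automorphism of the braid group with `T_i ↦ T_{σ i}`. -/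
noncomputable def braidAut (hσ : C.IsAdmissible σ) : C.Braid ≃* C.Braid :=
  MonoidHom.toMulEquiv (braidHom hσ) (braidHom hσ.symm)
    (PresentedGroup.ext fun i => by
      change braidHom hσ.symm (braidHom hσ (C.T i)) = C.T i
      rw [braidHom_T, braidHom_T, Equiv.symm_apply_apply])
    (PresentedGroup.ext fun i => by
      change braidHom hσ (braidHom hσ.symm (C.T i)) = C.T i
      rw [braidHom_T, braidHom_T, Equiv.apply_symm_apply])

theorem braidAut_T (hσ : C.IsAdmissible σ) (i : ι) : braidAut hσ (C.T i) = C.T (σ i) :=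
  braidHom_T hσ i

/-! ### The products over orbits -/

theorem commute_s {i j : ι} (h : C.A i j = 0) : Commute (C.s i) (C.s j) := by
  apply Subtype.ext
  apply LinearEquiv.toLinearMap_injective
  ext1 k
  ext1
  change C.reflection i (C.reflection j (Finsupp.single k 1)) =
    C.reflection j (C.reflection i (Finsupp.single k 1))
  simp only [reflection_single, map_sub, map_zsmul, h, C.zero_symm h, zero_smul, sub_zero]
  abel

theorem commute_T {i j : ι} (h : C.A i j = 0) : Commute (C.T i) (C.T j) := by
  rcases eq_or_ne i j with rfl | hij
  · exact Commute.refl _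
  have hm : C.m i j = 2 := by simp [m, hij, h]
  have := C.braid_relation i j
  rw [hm] at this
  simp only [alt, mul_one] at this
  exact this

/-- `ŝ_r = ∏ i ∈ O_r, s_i` (the factors commute). -/
noncomputable def sHat (hσ : C.IsAdmissible σ) (r : Orbits σ) : C.weyl :=
  (Orbits.toFinset σ r).noncommProd C.s fun _ hi _ hj hij =>
    commute_s (hσ.eq_zero ((Orbits.mem_toFinset.1 hi).trans (Orbits.mem_toFinset.1 hj).symm) hij)

/-- `T̂_r = ∏ i ∈ O_r, T_i` (the factors commute). -/
noncomputable def THat (hσ : C.IsAdmissible σ) (r : Orbits σ) : C.Braid :=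
  (Orbits.toFinset σ r).noncommProd C.T fun _ hi _ hj hij =>
    commute_T (hσ.eq_zero ((Orbits.mem_toFinset.1 hi).trans (Orbits.mem_toFinset.1 hj).symm) hij)

end FiniteCartan

/-!
# Folding of Weyl groups and braid groups

Everything is derived from one fact about root systems, `Signed`: each root `w α_i` has
coordinates of one sign. For `C` it comes from Mathlib's bases of root systems (`signed_of_base`);
for the dual `C'` of the folded matrix it is inherited from `C` (`signed_dualFold`). It yields the
exchange condition, the behaviour of lengths under alternating words, which only needs the
explicit root systems of rank two, and Matsumoto's theorem (`prod_map_eq_of_reduced`).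

*Weyl groups.* On the lattice of fixed vectors, with basis `β_r = ∑ i ∈ O_r, α_i`, the element
`ŝ_r` acts as the simple reflection `s_r` of `C'` (`sHat_fold`). A fixed `w` has the same sign on
all simple roots of an orbit, so it is determined by its action on the `β_r`, and its left
descents form a union of orbits. The first fact makes `w ↦ ŵ` a well defined injective
homomorphism, the second one shows that the `ŝ_r` generate the group of fixed points. Moreover
`w α_r` and `ŵ α_i`, `i ∈ O_r`, have the same sign, so `w ↦ ŵ` preserves products that add lengths
(`len_hat_mul`). Hence `T_w ↦ T_ŵ` respects the braid relations of `C'`.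

*Positive braids.* Given `u` and `x` in the Weyl group, there is a greatest initial factor `y` of
`x` such that `u * y` adds lengths (`exists_greatest_commonPre`). Writing `x = y z`, the rule
`u • (x, c) = (u y, T_z c)` defines an action of the braid monoid on pairs. The orbit map of
`(1, 1)` factors each positive braid as its greatest simple left divisor times a remainder, and
comparing these factorizations gives left cancellation (`simple_mul_left_cancel`). As `T_{w₀} ^ 2`
is central and a multiple of all generators, the braid monoid embeds in a monoid in which the
generators are invertible, hence in the braid group (`toBraid_injective`).

*Braid groups.* A fixed positive braid divisible by `T_i` is divisible by the product over the
orbit of `i`, so fixed positive braids are images of positive braids of `C'`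
(`exists_posFold_eq`). The map of braid monoids is injective because it preserves least common
multiples of generators (`posFold_injective`). Both statements pass to the groups, where each
element becomes positive after multiplication by a power of the fixed central element
`T_{w₀} ^ 2`.
-/

namespace FiniteCartan

variable {ι : Type*} [Fintype ι] (C : FiniteCartan ι)

/-! ### The invariant form and conjugation of simple reflections -/

theorem reflection_apply (i : ι) (v : ι →₀ ℤ) :
    C.reflection i v = v - Finsupp.linearCombination ℤ (C.A i) v • Finsupp.single i 1 := by
  simp [reflection, Module.reflection_apply]

theorem reflection_apply_of_ne {i k : ι} (h : k ≠ i) (v : ι →₀ ℤ) : C.reflection i v k = v k := by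
  simp [reflection_apply, h.symm]

/-- The symmetrized Cartan matrix defines a Weyl-invariant bilinear form on the root lattice. -/
theorem exists_invariant_form : ∃ (d : ι → ℤ) (B : (ι →₀ ℤ) →ₗ[ℤ] (ι →₀ ℤ) →ₗ[ℤ] ℤ),
    (∀ i, 0 < d i) ∧
    (∀ i v, B (Finsupp.single i 1) v = d i * Finsupp.linearCombination ℤ (C.A i) v) ∧
    ∀ (w : C.weyl) (x y : ι →₀ ℤ), B (w.1 x) (w.1 y) = B x y := by
  obtain ⟨d, hd, hs, -⟩ := C.posDef
  let B : (ι →₀ ℤ) →ₗ[ℤ] (ι →₀ ℤ) →ₗ[ℤ] ℤ :=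
    Finsupp.linearCombination ℤ fun i => d i • Finsupp.linearCombination ℤ (C.A i)
  have hl : ∀ i v, B (Finsupp.single i 1) v = d i * Finsupp.linearCombination ℤ (C.A i) v :=
    fun i v => by simp [B]
  have hr : ∀ i v, B v (Finsupp.single i 1) = d i * Finsupp.linearCombination ℤ (C.A i) v := by
    intro i v
    induction v using Finsupp.induction_linear with
    | zero => simp
    | add f g hf hg => rw [map_add, LinearMap.add_apply, hf, hg, map_add, mul_add]
    | single j c =>
      rw [← mul_one c, ← smul_eq_mul, ← Finsupp.smul_single, map_smul, map_smul,
        LinearMap.smul_apply, hl]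
      simp only [Finsupp.linearCombination_single, smul_eq_mul]
      linear_combination c * hs j i
  refine ⟨d, B, hd, hl, ?_⟩
  rintro ⟨w, hw⟩
  change ∀ x y : ι →₀ ℤ, B (w x) (w y) = B x y
  induction hw using Subgroup.closure_induction with
  | mem w hw =>
    obtain ⟨i, rfl⟩ := hw
    intro x y
    simp only [reflection_apply, map_sub, LinearMap.sub_apply, map_smul, LinearMap.smul_apply,
      hl, hr, smul_eq_mul, Finsupp.linearCombination_single, C.diag]
    ring
  | one => intro x y; rfl
  | mul u v _ _ hu hv => intro x y; exact (hu _ _).trans (hv x y)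
  | inv u _ hu =>
    intro x y
    have h := hu (u⁻¹ x) (u⁻¹ y)
    change B (u (u.symm x)) (u (u.symm y)) = _ at h
    simpa using h.symm

variable {C}

theorem s_mul_self (i : ι) : C.s i * C.s i = 1 := Subtype.ext (C.reflection_mul_self i)

theorem mul_s_mul_s (w : C.weyl) (i : ι) : w * C.s i * C.s i = w := by
  rw [mul_assoc, s_mul_self, mul_one]

theorem s_mul_s_mul (w : C.weyl) (i : ι) : C.s i * (C.s i * w) = w := by
  rw [← mul_assoc, s_mul_self, one_mul]

theorem s_inv (i : ι) : (C.s i)⁻¹ = C.s i := inv_eq_of_mul_eq_one_left (s_mul_self i)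

theorem s_apply_self (i : ι) :
    (C.s i).1 (Finsupp.single i 1) = -Finsupp.single i 1 := by
  change C.reflection i _ = _
  rw [reflection_single, C.diag]
  module

theorem mul_apply (u v : C.weyl) (x : ι →₀ ℤ) : (u * v).1 x = u.1 (v.1 x) := rfl

theorem inv_apply_self (u : C.weyl) (x : ι →₀ ℤ) : (u⁻¹).1 (u.1 x) = x := by
  rw [← mul_apply, inv_mul_cancel]; rfl

/-- `w s_i w⁻¹ = s_j` if `w α_i = α_j`: by the invariant form, a reflection is determined by its
root. -/
theorem mul_s_eq_s_mul {w : C.weyl} {i j : ι}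
    (h : w.1 (Finsupp.single i 1) = Finsupp.single j 1) : w * C.s i = C.s j * w := by
  obtain ⟨d, B, hd, hB, hw⟩ := C.exists_invariant_form
  have key : ∀ v, d j * Finsupp.linearCombination ℤ (C.A j) (w.1 v) =
      d i * Finsupp.linearCombination ℤ (C.A i) v := fun v => by
    rw [← hB, ← hB, ← h, hw]
  have hij : d j = d i := by
    have := key (Finsupp.single i 1)
    rw [h] at this
    simp only [Finsupp.linearCombination_single, C.diag, smul_eq_mul] at this
    linarith
  apply Subtype.ext
  apply LinearEquiv.ext
  intro v
  change w.1 (C.reflection i v) = C.reflection j (w.1 v)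
  rw [reflection_apply, reflection_apply, map_sub, map_zsmul, h]
  have := key v
  rw [hij] at this
  rw [mul_left_cancel₀ (hd i).ne' this]

/-! ### Signs of roots, and the exchange condition -/

variable (C) in
/-- Every root `w α_i` has all its coordinates non-negative, or all of them non-positive. This is
the only input from the theory of root systems. -/
def Signed : Prop :=
  ∀ (w : C.weyl) (i : ι), 0 ≤ w.1 (Finsupp.single i 1) ∨ w.1 (Finsupp.single i 1) ≤ 0

theorem not_apply_single_nonneg_and_nonpos (w : C.weyl) (i : ι)
    (h0 : 0 ≤ w.1 (Finsupp.single i 1)) (h1 : w.1 (Finsupp.single i 1) ≤ 0) : False := by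
  have h := le_antisymm h1 h0
  rw [map_eq_zero_iff _ w.1.injective] at h
  simp at h

theorem mul_s_apply_single (w : C.weyl) (i : ι) :
    (w * C.s i).1 (Finsupp.single i 1) = -w.1 (Finsupp.single i 1) := by
  rw [mul_apply, s_apply_self, map_neg]

/-- A simple reflection changes the sign of only one positive root. -/
theorem eq_single_of_reflection_nonpos {w : C.weyl} {i j : ι}
    (h0 : 0 ≤ w.1 (Finsupp.single i 1)) (h1 : (C.s j * w).1 (Finsupp.single i 1) ≤ 0) :
    w.1 (Finsupp.single i 1) = Finsupp.single j 1 := by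
  classical
  set β := w.1 (Finsupp.single i 1) with hβ
  have hk : ∀ k, k ≠ j → β k = 0 := fun k hk => by
    refine le_antisymm ?_ (h0 k)
    rw [← C.reflection_apply_of_ne hk]
    exact h1 k
  have hβj : β = β j • Finsupp.single j 1 := by
    ext k
    by_cases h : k = j
    · subst h; simp
    · simp [hk k h, Ne.symm h]
  -- `β` is primitive, being the image of a basis vector
  have h2 : Finsupp.single i 1 = β j • (w⁻¹).1 (Finsupp.single j 1) := by
    rw [← map_zsmul, ← hβj, hβ, inv_apply_self]
  have h3 := DFunLike.congr_fun h2 i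
  simp only [Finsupp.single_eq_same, Finsupp.smul_apply, smul_eq_mul] at h3
  have h4 : β j = 1 := Int.eq_one_of_dvd_one (h0 j) ⟨_, h3⟩
  rw [hβj, h4, one_smul]

/-- The exchange condition: if `w α_i` is negative, a word of `w * s_i` is obtained from a word of
`w` by deleting the letter whose reflection makes the root negative. -/
theorem exists_shorter_word (hs : C.Signed) (i : ι) (l : List ι)
    (h : (l.map C.s).prod.1 (Finsupp.single i 1) ≤ 0) :
    ∃ l' : List ι, l'.length + 1 = l.length ∧ (l'.map C.s).prod = (l.map C.s).prod * C.s i := by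
  induction l with
  | nil => exact (not_apply_single_nonneg_and_nonpos (1 : C.weyl) i (by simp) h).elim
  | cons j l ih =>
    rw [List.map_cons, List.prod_cons] at h ⊢
    rcases hs (l.map C.s).prod i with h0 | h0
    · refine ⟨l, rfl, ?_⟩
      rw [mul_assoc, mul_s_eq_s_mul (eq_single_of_reflection_nonpos h0 h), s_mul_s_mul]
    · obtain ⟨l', h1, h2⟩ := ih h0
      exact ⟨j :: l', by simp [h1], by rw [List.map_cons, List.prod_cons, h2, mul_assoc]⟩

/-! ### The length function -/

/-- The length of an element of the Weyl group: the number of letters of a reduced word. -/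
noncomputable def len (w : C.weyl) : ℕ := (C.exists_isReducedWord w).choose.length

/-- A chosen reduced word. -/
noncomputable def redWord (w : C.weyl) : List ι := (C.exists_isReducedWord w).choose

theorem redWord_spec (w : C.weyl) : C.IsReducedWord w (redWord w) :=
  (C.exists_isReducedWord w).choose_spec

theorem prod_redWord (w : C.weyl) : ((redWord w).map C.s).prod = w := (redWord_spec w).1

theorem length_redWord (w : C.weyl) : (redWord w).length = len w := rfl

theorem len_le (w : C.weyl) (l : List ι) (h : (l.map C.s).prod = w) : len w ≤ l.length :=
  (redWord_spec w).2 l h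

theorem isReducedWord_iff {w : C.weyl} {l : List ι} :
    C.IsReducedWord w l ↔ (l.map C.s).prod = w ∧ l.length = len w :=
  ⟨fun h => ⟨h.1, le_antisymm (h.2 _ (prod_redWord w)) (len_le w l h.1)⟩,
    fun h => ⟨h.1, fun l' hl' => h.2 ▸ len_le w l' hl'⟩⟩

@[simp] theorem len_one : len (1 : C.weyl) = 0 := Nat.le_zero.1 (len_le 1 [] rfl)

theorem eq_one_of_len_eq_zero {w : C.weyl} (h : len w = 0) : w = 1 := by
  rw [← prod_redWord w, List.eq_nil_of_length_eq_zero (show (redWord w).length = 0 from h)]; rfl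

theorem len_mul_le (u v : C.weyl) : len (u * v) ≤ len u + len v := by
  refine (len_le _ (redWord u ++ redWord v) ?_).trans_eq List.length_append
  rw [List.map_append, List.prod_append, prod_redWord, prod_redWord]

theorem len_inv_le (u : C.weyl) : len u⁻¹ ≤ len u := by
  refine (len_le _ (redWord u).reverse ?_).trans_eq List.length_reverse
  conv_rhs => rw [← prod_redWord u, List.prod_inv_reverse, List.map_map]
  rw [List.map_reverse]
  exact congrArg (fun f => ((redWord u).map f).reverse.prod) (funext fun i => (s_inv i).symm)

@[simp] theorem len_inv (u : C.weyl) : len u⁻¹ = len u :=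
  le_antisymm (len_inv_le u) (by simpa using len_inv_le u⁻¹)

theorem len_s_le (i : ι) : len (C.s i) ≤ 1 := len_le _ [i] (by simp)

theorem len_mul_s_of_nonpos (hs : C.Signed) {w : C.weyl} {i : ι}
    (h : w.1 (Finsupp.single i 1) ≤ 0) : len (w * C.s i) + 1 = len w := by
  apply le_antisymm
  · rw [← prod_redWord w] at h
    obtain ⟨l, hl, hp⟩ := exists_shorter_word hs i _ h
    rw [prod_redWord] at hp
    rw [← length_redWord w, ← hl]
    exact Nat.succ_le_succ (len_le _ _ hp)
  · conv_lhs => rw [← mul_s_mul_s w i]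
    exact (len_mul_le _ _).trans (Nat.add_le_add_left (len_s_le i) _)

theorem len_mul_s_of_nonneg (hs : C.Signed) {w : C.weyl} {i : ι}
    (h : 0 ≤ w.1 (Finsupp.single i 1)) : len (w * C.s i) = len w + 1 := by
  have := len_mul_s_of_nonpos hs (w := w * C.s i) (i := i)
    (by rw [mul_s_apply_single]; exact neg_nonpos.2 h)
  rw [mul_s_mul_s] at this
  exact this.symm

theorem nonneg_iff_len (hs : C.Signed) {w : C.weyl} {i : ι} :
    0 ≤ w.1 (Finsupp.single i 1) ↔ len (w * C.s i) = len w + 1 :=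
  ⟨len_mul_s_of_nonneg hs, fun h => (hs w i).resolve_right fun h0 => by
    have := len_mul_s_of_nonpos hs h0; omega⟩

theorem nonpos_iff_len (hs : C.Signed) {w : C.weyl} {i : ι} :
    w.1 (Finsupp.single i 1) ≤ 0 ↔ len (w * C.s i) + 1 = len w :=
  ⟨len_mul_s_of_nonpos hs, fun h => (hs w i).resolve_left fun h0 => by
    have := len_mul_s_of_nonneg hs h0; omega⟩

theorem len_s_mul (i : ι) (w : C.weyl) : len (C.s i * w) = len (w⁻¹ * C.s i) := by
  rw [← len_inv, mul_inv_rev, s_inv]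

theorem len_s (hs : C.Signed) (i : ι) : len (C.s i) = 1 := by
  have := len_mul_s_of_nonneg hs (w := 1) (i := i) (by change 0 ≤ Finsupp.single i 1; simp)
  simpa using this

/-! ### Rank two -/

/-- The form is positive on the rank two lattice spanned by `α_i` and `α_j`. -/
theorem mul_lt_four {i j : ι} (hij : i ≠ j) : C.A i j * C.A j i < 4 := by
  classical
  obtain ⟨d, hd, hs, hp⟩ := C.posDef
  have hi := hd i
  have hj := hd j
  -- this vector spans the orthogonal complement of `α_i` in the plane of `α_i` and `α_j`
  have h := hp (Pi.single i (-(d i * C.A i j)) + Pi.single j (2 * d i)) (fun h => by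
    have := congrFun h j
    simp [hij.symm] at this
    omega)
  have e : ∀ p q : ℤ, ∑ k, ∑ l, (Pi.single i p + Pi.single j q : ι → ℤ) k * (d k * C.A k l) *
      (Pi.single i p + Pi.single j q : ι → ℤ) l =
      p * (d i * C.A i i) * p + p * (d i * C.A i j) * q + q * (d j * C.A j i) * p +
        q * (d j * C.A j j) * q := fun p q => by
    simp only [Pi.add_apply, Pi.single_apply, add_mul, mul_add, ite_mul, mul_ite, zero_mul,
      mul_zero, Finset.sum_add_distrib, Finset.sum_ite_eq', Finset.mem_univ, if_true]
    ring
  rw [e, C.diag, C.diag, ← hs i j] at h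
  have h1 : (d i * C.A i j) * (d i * C.A i j) = d i * d j * (C.A i j * C.A j i) := by
    conv_lhs => enter [2]; rw [hs]
    ring
  have h2 : 0 < 2 * (d i * (d i * d j)) * (4 - C.A i j * C.A j i) := by nlinarith
  have h3 : 0 < 2 * (d i * (d i * d j)) := by positivity
  have := (mul_pos_iff_of_pos_left h3).1 h2
  linarith

/-- The last letter of the alternating word `x y x ⋯` with `n + 1` letters. -/
def altLast {X : Type*} : ℕ → X → X → X
  | 0, x, _ => x
  | n + 1, x, y => altLast n y x

theorem alt_succ_right {G X : Type*} [Monoid G] (f : X → G) (n : ℕ) :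
    ∀ x y : X, alt (f x) (f y) (n + 1) = alt (f x) (f y) n * f (altLast n x y) := by
  induction n with
  | zero => intro x y; simp [alt, altLast]
  | succ n ih =>
    intro x y
    rw [alt, ih, ← mul_assoc]
    rfl

/-- The coordinates of the root `s_i s_j s_i ⋯ (α)` with `n` reflections, where `α` is the simple
root `α_i` or `α_j` that continues the alternating word, with respect to `α_i`, `α_j`. The
arguments are `-a i j` and `-a j i`. -/
def altCoeff : ℕ → ℤ → ℤ → ℤ × ℤ
  | 0, _, _ => (1, 0)
  | n + 1, a, b => (a * (altCoeff n b a).1 - (altCoeff n b a).2, (altCoeff n b a).1)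

theorem alt_apply_altLast (n : ℕ) : ∀ i j : ι,
    (alt (C.s i) (C.s j) n).1 (Finsupp.single (altLast n i j) 1) =
      (altCoeff n (-C.A i j) (-C.A j i)).1 • Finsupp.single i 1 +
      (altCoeff n (-C.A i j) (-C.A j i)).2 • Finsupp.single j 1 := by
  induction n with
  | zero => intro i j; simp [alt, altLast, altCoeff]
  | succ n ih =>
    intro i j
    rw [alt, mul_apply, altLast, ih j i, map_add, map_zsmul, map_zsmul]
    change _ • C.reflection i _ + _ • C.reflection i _ = _
    rw [reflection_single, reflection_single, C.diag, altCoeff]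
    module

/-- The finite type Cartan matrices of rank two. -/
theorem cartan_cases {i j : ι} (hij : i ≠ j) :
    (C.A i j = 0 ∧ C.A j i = 0 ∧ C.m i j = 2) ∨ (C.A i j = -1 ∧ C.A j i = -1 ∧ C.m i j = 3) ∨
    (C.A i j = -1 ∧ C.A j i = -2 ∧ C.m i j = 4) ∨ (C.A i j = -2 ∧ C.A j i = -1 ∧ C.m i j = 4) ∨
    (C.A i j = -1 ∧ C.A j i = -3 ∧ C.m i j = 6) ∨ (C.A i j = -3 ∧ C.A j i = -1 ∧ C.m i j = 6) := by
  by_cases h0 : C.A i j = 0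
  · have h1 := C.zero_symm h0
    simp [h0, h1, m, hij]
  have h1 : C.A j i ≠ 0 := fun h => h0 (C.zero_symm h)
  have h2 := C.nonpos i j hij
  have h3 := C.nonpos j i hij.symm
  have h4 := mul_lt_four (C := C) hij
  have h5 : -3 ≤ C.A i j := by nlinarith [lt_of_le_of_ne h3 h1]
  have h6 : -3 ≤ C.A j i := by nlinarith [lt_of_le_of_ne h2 h0]
  have hm : C.m i j = if C.A i j * C.A j i = 0 then 2 else if C.A i j * C.A j i = 1 then 3
      else if C.A i j * C.A j i = 2 then 4 else 6 := by
    simp [m, hij]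
  generalize C.A i j = a at *
  generalize C.A j i = b at *
  rw [hm]
  interval_cases a <;> interval_cases b <;> simp_all

theorem altCoeff_nonneg {i j : ι} (hij : i ≠ j) {n : ℕ} (hn : n < C.m i j) :
    0 ≤ (altCoeff n (-C.A i j) (-C.A j i)).1 ∧ 0 ≤ (altCoeff n (-C.A i j) (-C.A j i)).2 := by
  rcases cartan_cases (C := C) hij with ⟨h1, h2, h3⟩ | ⟨h1, h2, h3⟩ | ⟨h1, h2, h3⟩ | ⟨h1, h2, h3⟩ |
    ⟨h1, h2, h3⟩ | ⟨h1, h2, h3⟩ <;> rw [h3] at hn <;> rw [h1, h2] <;> interval_cases n <;> decide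

theorem m_symm (i j : ι) : C.m i j = C.m j i := by
  rcases eq_or_ne i j with rfl | hij
  · rfl
  simp [m, hij, hij.symm, mul_comm (C.A i j)]

/-- Multiplication by an alternating word whose two letters are both ascents adds lengths. -/
theorem len_mul_alt_of_nonneg (hs : C.Signed) {w : C.weyl} {i j : ι} (hij : i ≠ j)
    (hi : 0 ≤ w.1 (Finsupp.single i 1)) (hj : 0 ≤ w.1 (Finsupp.single j 1)) {n : ℕ}
    (hn : n ≤ C.m i j) : len (w * alt (C.s i) (C.s j) n) = len w + n := by
  induction n with
  | zero => simp [alt]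
  | succ n ih =>
    rw [alt_succ_right, ← mul_assoc, len_mul_s_of_nonneg hs, ih (by omega), add_assoc]
    obtain ⟨h1, h2⟩ := altCoeff_nonneg (C := C) hij hn
    rw [mul_apply, alt_apply_altLast, map_add, map_zsmul, map_zsmul]
    exact add_nonneg (zsmul_nonneg hi h1) (zsmul_nonneg hj h2)

/-- Multiplication by an alternating word whose two letters are both descents subtracts lengths. -/
theorem len_mul_alt_of_nonpos (hs : C.Signed) {w : C.weyl} {i j : ι} (hij : i ≠ j)
    (hi : w.1 (Finsupp.single i 1) ≤ 0) (hj : w.1 (Finsupp.single j 1) ≤ 0) {n : ℕ}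
    (hn : n ≤ C.m i j) : len (w * alt (C.s i) (C.s j) n) + n = len w := by
  induction n with
  | zero => simp [alt]
  | succ n ih =>
    rw [← ih (by omega), alt_succ_right, ← mul_assoc, add_comm n, ← add_assoc,
      len_mul_s_of_nonpos hs]
    obtain ⟨h1, h2⟩ := altCoeff_nonneg (C := C) hij hn
    rw [mul_apply, alt_apply_altLast, map_add, map_zsmul, map_zsmul]
    exact add_nonpos (smul_nonpos_of_nonneg_of_nonpos h1 hi)
      (smul_nonpos_of_nonneg_of_nonpos h2 hj)

/-- The braid relations hold in the Weyl group. -/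
theorem alt_s (i j : ι) : alt (C.s i) (C.s j) (C.m i j) = alt (C.s j) (C.s i) (C.m i j) := by
  rcases eq_or_ne i j with rfl | hij
  · rfl
  apply Subtype.ext
  apply LinearEquiv.ext
  intro v
  rcases cartan_cases (C := C) hij with ⟨h1, h2, h3⟩ | ⟨h1, h2, h3⟩ | ⟨h1, h2, h3⟩ | ⟨h1, h2, h3⟩ |
    ⟨h1, h2, h3⟩ | ⟨h1, h2, h3⟩ <;> rw [h3] <;>
  · simp only [alt, mul_one, mul_apply]
    simp only [s, reflection_apply, map_sub, map_zsmul, smul_eq_mul,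
      Finsupp.linearCombination_single, C.diag, h1, h2]
    module

/-! ### Matsumoto's theorem -/

/-- The alternating word `x, y, x, …` with `n` letters. -/
def altWord {X : Type*} (x y : X) : ℕ → List X
  | 0 => []
  | n + 1 => x :: altWord y x n

theorem altWord_succ {X : Type*} (x y : X) (n : ℕ) :
    altWord x y (n + 1) = x :: altWord y x n := rfl

theorem length_altWord {X : Type*} (n : ℕ) : ∀ x y : X, (altWord x y n).length = n := by
  induction n with
  | zero => intro x y; rfl
  | succ n ih => intro x y; rw [altWord, List.length_cons, ih]

theorem prod_map_altWord {X G : Type*} [Monoid G] (f : X → G) (n : ℕ) :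
    ∀ x y : X, ((altWord x y n).map f).prod = alt (f x) (f y) n := by
  induction n with
  | zero => intro x y; rfl
  | succ n ih => intro x y; rw [altWord, List.map_cons, List.prod_cons, ih, alt]

theorem two_le_m {i j : ι} (hij : i ≠ j) : 2 ≤ C.m i j := by
  rcases cartan_cases (C := C) hij with ⟨-, -, h⟩ | ⟨-, -, h⟩ | ⟨-, -, h⟩ | ⟨-, -, h⟩ |
    ⟨-, -, h⟩ | ⟨-, -, h⟩ <;> omega

variable (C) in
/-- The family `f` satisfies the braid relations of `C`. -/
def IsBraided {G : Type*} [Monoid G] (f : ι → G) : Prop :=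
  ∀ i j, alt (f i) (f j) (C.m i j) = alt (f j) (f i) (C.m i j)

variable (C) in
/-- The word `l` is reduced: it has as many letters as the length of its product. -/
def Reduced (l : List ι) : Prop := l.length = len (l.map C.s).prod

theorem reduced_redWord (w : C.weyl) : C.Reduced (redWord w) := by
  rw [Reduced, prod_redWord, length_redWord]

theorem Reduced.of_cons {i : ι} {l : List ι} (h : C.Reduced (i :: l)) : C.Reduced l := by
  apply le_antisymm _ (len_le _ _ rfl)
  rw [Reduced, List.map_cons, List.prod_cons, List.length_cons] at h
  have := len_mul_le (C.s i) (l.map C.s).prod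
  have := len_s_le (C := C) i
  omega

theorem Reduced.left_descent (hs : C.Signed) {i : ι} {l : List ι} (h : C.Reduced (i :: l)) :
    ((l.map C.s).prod⁻¹ * C.s i).1 (Finsupp.single i 1) ≤ 0 := by
  have h' := h.of_cons
  rw [Reduced] at h h'
  rw [nonpos_iff_len hs, mul_s_mul_s, len_inv, ← h', ← len_s_mul, ← List.prod_cons,
    ← List.map_cons, ← h, List.length_cons]

/-- If `i ≠ j` are left descents of `w`, the longest alternating word in `i`, `j` is an initial
factor of `w`. -/
theorem len_alt_inv_mul (hs : C.Signed) {w : C.weyl} {i j : ι} (hij : i ≠ j)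
    (hi : (w⁻¹).1 (Finsupp.single i 1) ≤ 0) (hj : (w⁻¹).1 (Finsupp.single j 1) ≤ 0) :
    len ((alt (C.s i) (C.s j) (C.m i j))⁻¹ * w) + C.m i j = len w := by
  have := len_mul_alt_of_nonpos hs hij hi hj le_rfl
  rwa [len_inv, ← len_inv, mul_inv_rev, inv_inv] at this

/-- Matsumoto's theorem: two reduced words of the same element have equal products under a family
that satisfies the braid relations. The induction is on the length of the words. -/
theorem prod_map_eq_of_reduced (hs : C.Signed) {G : Type*} [Monoid G] {f : ι → G}
    (hf : C.IsBraided f) (n : ℕ) : ∀ l l' : List ι, l.length = n → C.Reduced l → C.Reduced l' →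
      (l.map C.s).prod = (l'.map C.s).prod → (l.map f).prod = (l'.map f).prod := by
  induction n with
  | zero =>
    intro l l' hl hr hr' h
    rw [List.eq_nil_of_length_eq_zero hl] at h ⊢
    have : l'.length = 0 := by rw [hr', ← h]; exact len_one
    rw [List.eq_nil_of_length_eq_zero this]
  | succ n ih =>
    have cons : ∀ (i : ι) (l l' : List ι), l.length = n → C.Reduced (i :: l) →
        C.Reduced (i :: l') → ((i :: l).map C.s).prod = ((i :: l').map C.s).prod →
        ((i :: l).map f).prod = ((i :: l').map f).prod := by
      intro i l l' hl hr hr' h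
      rw [List.map_cons, List.map_cons, List.prod_cons, List.prod_cons] at h ⊢
      rw [ih l l' hl hr.of_cons hr'.of_cons (mul_left_cancel h)]
    rintro (_ | ⟨i, l⟩) l' hl hr hr' h
    · simp at hl
    have hll' : (i :: l).length = l'.length := by rw [hr, hr', h]
    rcases l' with _ | ⟨j, l'⟩
    · simp at hll'
    simp only [List.length_cons] at hl hll'
    rcases eq_or_ne i j with rfl | hij
    · exact cons i l l' (by omega) hr hr' h
    -- both words are compared with words that begin with the alternating words in `i`, `j`
    set w := ((i :: l).map C.s).prod with hw
    have hi : (w⁻¹).1 (Finsupp.single i 1) ≤ 0 := by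
      have := hr.left_descent hs
      rwa [← s_inv, ← mul_inv_rev, ← List.prod_cons, ← List.map_cons] at this
    have hj : (w⁻¹).1 (Finsupp.single j 1) ≤ 0 := by
      have := hr'.left_descent hs
      rwa [← s_inv, ← mul_inv_rev, ← List.prod_cons, ← List.map_cons, ← h] at this
    have hlen := len_alt_inv_mul hs hij hi hj
    set v := (alt (C.s i) (C.s j) (C.m i j))⁻¹ * w with hv
    have hwv : alt (C.s i) (C.s j) (C.m i j) * v = w := by rw [hv, mul_inv_cancel_left]
    have hprod : ∀ {H : Type _} [Monoid H] (g : ι → H) (a b : ι),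
        ((altWord a b (C.m i j) ++ redWord v).map g).prod =
          alt (g a) (g b) (C.m i j) * ((redWord v).map g).prod := fun g a b => by
      rw [List.map_append, List.prod_append, prod_map_altWord]
    have hp1 : ((altWord i j (C.m i j) ++ redWord v).map C.s).prod = w := by
      rw [hprod, prod_redWord, hwv]
    have hp2 : ((altWord j i (C.m i j) ++ redWord v).map C.s).prod = w := by
      rw [hprod, prod_redWord, ← alt_s, hwv]
    have hr1 : C.Reduced (altWord i j (C.m i j) ++ redWord v) := by
      rw [Reduced, hp1, List.length_append, length_altWord, length_redWord, add_comm, hlen]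
    have hr2 : C.Reduced (altWord j i (C.m i j) ++ redWord v) := by
      rw [Reduced, hp2, List.length_append, length_altWord, length_redWord, add_comm, hlen]
    have he : ((altWord i j (C.m i j) ++ redWord v).map f).prod =
        ((altWord j i (C.m i j) ++ redWord v).map f).prod := by
      rw [List.map_append, List.prod_append, prod_map_altWord, hf, List.map_append,
        List.prod_append, prod_map_altWord]
    obtain ⟨k, hk⟩ : ∃ k, C.m i j = k + 1 := ⟨C.m i j - 1, by have := two_le_m (C := C) hij; omega⟩
    simp only [hk, altWord_succ, List.cons_append] at hp1 hp2 hr1 hr2 he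
    rw [cons i l _ (by omega) hr hr1 hp1.symm, he]
    exact (cons j l' _ (by omega) hr' hr2 (h.symm.trans hp2.symm)).symm

/-- The product of a family `f` along a reduced word of `w`. If `f` satisfies the braid relations,
it does not depend on the reduced word. -/
noncomputable def wordMap {G : Type*} [Monoid G] (f : ι → G) (w : C.weyl) : G :=
  ((redWord w).map f).prod

section wordMap

variable {G : Type*} [Monoid G] {f : ι → G}

theorem prod_map_eq_wordMap (hs : C.Signed) (hf : C.IsBraided f) {l : List ι} (hl : C.Reduced l) :
    (l.map f).prod = wordMap f (l.map C.s).prod :=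
  prod_map_eq_of_reduced hs hf _ _ _ rfl hl (reduced_redWord _) (prod_redWord _).symm

theorem wordMap_mul (hs : C.Signed) (hf : C.IsBraided f) {u v : C.weyl}
    (h : len (u * v) = len u + len v) : wordMap f (u * v) = wordMap f u * wordMap f v := by
  have hp : ((redWord u ++ redWord v).map C.s).prod = u * v := by
    rw [List.map_append, List.prod_append, prod_redWord, prod_redWord]
  have := prod_map_eq_wordMap hs hf (l := redWord u ++ redWord v)
    (by rw [Reduced, hp, h, List.length_append, length_redWord, length_redWord])
  rw [hp] at this
  rw [← this, List.map_append, List.prod_append, wordMap, wordMap]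

theorem wordMap_one : wordMap f (1 : C.weyl) = 1 := by
  rw [wordMap, List.eq_nil_of_length_eq_zero (show (redWord (1 : C.weyl)).length = 0 from len_one)]
  rfl

theorem wordMap_s (hs : C.Signed) (hf : C.IsBraided f) (i : ι) : wordMap f (C.s i) = f i := by
  have := prod_map_eq_wordMap hs hf (l := [i]) (by simp [Reduced, len_s hs])
  simpa using this.symm

theorem len_alt (hs : C.Signed) {i j : ι} (hij : i ≠ j) {n : ℕ} (hn : n ≤ C.m i j) :
    len (alt (C.s i) (C.s j) n) = n := by
  have h : ∀ k, 0 ≤ (1 : C.weyl).1 (Finsupp.single k 1) := fun k => by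
    change 0 ≤ Finsupp.single k 1; simp
  simpa using len_mul_alt_of_nonneg hs hij (h i) (h j) hn

theorem reduced_altWord (hs : C.Signed) {i j : ι} (hij : i ≠ j) {n : ℕ} (hn : n ≤ C.m i j) :
    C.Reduced (altWord i j n) := by
  rw [Reduced, prod_map_altWord, len_alt hs hij hn, length_altWord]

theorem wordMap_alt (hs : C.Signed) (hf : C.IsBraided f) {i j : ι} (hij : i ≠ j) {n : ℕ}
    (hn : n ≤ C.m i j) : wordMap f (alt (C.s i) (C.s j) n) = alt (f i) (f j) n := by
  rw [← prod_map_altWord, ← prod_map_altWord,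
    prod_map_eq_wordMap hs hf (reduced_altWord hs hij hn)]

theorem prod_map_eq_of_mul (hs : C.Signed) {g : C.weyl → G} (h1 : g 1 = 1)
    (hg : ∀ u v, len (u * v) = len u + len v → g (u * v) = g u * g v) {l : List ι}
    (hl : C.Reduced l) : (l.map fun i => g (C.s i)).prod = g (l.map C.s).prod := by
  induction l with
  | nil => exact h1.symm
  | cons i l ih =>
    rw [List.map_cons, List.prod_cons, ih hl.of_cons, List.map_cons, List.prod_cons, hg]
    have h' := hl.of_cons
    rw [Reduced, List.map_cons, List.prod_cons, List.length_cons] at hl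
    rw [Reduced] at h'
    rw [← hl, len_s hs, ← h', add_comm]

/-- A family of elements indexed by the Weyl group that is multiplicative on products that add
lengths restricts to a family that satisfies the braid relations. -/
theorem isBraided_of_mul (hs : C.Signed) {g : C.weyl → G} (h1 : g 1 = 1)
    (hg : ∀ u v, len (u * v) = len u + len v → g (u * v) = g u * g v) :
    C.IsBraided fun i => g (C.s i) := by
  intro i j
  rcases eq_or_ne i j with rfl | hij
  · rfl
  have key : ∀ (i j : ι), i ≠ j → alt (g (C.s i)) (g (C.s j)) (C.m i j) =
      g (alt (C.s i) (C.s j) (C.m i j)) := fun i j hij => by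
    rw [← prod_map_altWord C.s, ← prod_map_eq_of_mul hs h1 hg (reduced_altWord hs hij le_rfl),
      prod_map_altWord]
  rw [key i j hij, alt_s, m_symm, key j i hij.symm]

theorem wordMap_eq_of_mul (hs : C.Signed) {g : C.weyl → G} (h1 : g 1 = 1)
    (hg : ∀ u v, len (u * v) = len u + len v → g (u * v) = g u * g v) (w : C.weyl) :
    wordMap (fun i => g (C.s i)) w = g w := by
  rw [wordMap, prod_map_eq_of_mul hs h1 hg (reduced_redWord w), prod_redWord]

end wordMap

/-! ### The braid monoid -/

variable (C) in
/-- The braid relations, as relations between words. -/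
inductive BraidRel : FreeMonoid ι → FreeMonoid ι → Prop
  | alt (i j : ι) : BraidRel (alt (.of i) (.of j) (C.m i j)) (alt (.of j) (.of i) (C.m i j))

variable (C) in
/-- The monoid of positive braids. -/
abbrev BraidMonoid : Type _ := PresentedMonoid C.BraidRel

variable (C) in
/-- The generators of the monoid of positive braids. -/
def pos (i : ι) : C.BraidMonoid := PresentedMonoid.of C.BraidRel i

variable (C) in
theorem isBraided_pos : C.IsBraided C.pos := fun i j => by
  have h := PresentedMonoid.mk_eq_mk_of_rel (BraidRel.alt (C := C) i j)
  rw [map_alt, map_alt] at h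
  exact h

/-- A family that satisfies the braid relations extends to the monoid of positive braids. -/
noncomputable def posLift {G : Type*} [Monoid G] (f : ι → G) (hf : C.IsBraided f) :
    C.BraidMonoid →* G :=
  PresentedMonoid.lift f (by
    rintro _ _ ⟨i, j⟩
    rw [map_alt, map_alt, FreeMonoid.lift_eval_of, FreeMonoid.lift_eval_of, hf])

theorem posLift_pos {G : Type*} [Monoid G] (f : ι → G) (hf : C.IsBraided f) (i : ι) :
    posLift f hf (C.pos i) = f i := PresentedMonoid.lift_of ..

theorem pos_induction {p : C.BraidMonoid → Prop} (one : p 1)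
    (pos_mul : ∀ i b, p b → p (C.pos i * b)) (b : C.BraidMonoid) : p b := by
  obtain ⟨l, rfl⟩ := PresentedMonoid.surjective_mk b
  induction l using FreeMonoid.recOn with
  | one => exact one
  | of_mul i l hl => rw [map_mul]; exact pos_mul i _ hl

theorem map_wordMap {G H : Type*} [Monoid G] [Monoid H] (φ : G →* H) (f : ι → G) (w : C.weyl) :
    φ (wordMap f w) = wordMap (φ ∘ f) w := by
  rw [wordMap, wordMap, map_list_prod, List.map_map]

theorem isBraided_const {G : Type*} [Monoid G] (x : G) : C.IsBraided fun _ => x := fun _ _ => rfl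

/-- The number of letters of a positive braid. -/
noncomputable def deg : C.BraidMonoid →* Multiplicative ℕ :=
  posLift _ (isBraided_const (Multiplicative.ofAdd 1))

theorem deg_pos (i : ι) : deg (C.pos i) = Multiplicative.ofAdd 1 := posLift_pos ..

theorem deg_pos_mul (i : ι) (b : C.BraidMonoid) :
    (deg (C.pos i * b)).toAdd = (deg b).toAdd + 1 := by
  rw [map_mul, deg_pos, toAdd_mul, toAdd_ofAdd, add_comm]

/-- The element `T_w` of the monoid of positive braids. -/
noncomputable def simple (w : C.weyl) : C.BraidMonoid := wordMap C.pos w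

theorem simple_mul (hs : C.Signed) {u v : C.weyl} (h : len (u * v) = len u + len v) :
    simple (u * v) = simple u * simple v := wordMap_mul hs C.isBraided_pos h

theorem simple_one : simple (1 : C.weyl) = 1 := wordMap_one

theorem simple_s (hs : C.Signed) (i : ι) : simple (C.s i) = C.pos i :=
  wordMap_s hs C.isBraided_pos i

/-! ### The weak order -/

/-- The weak order: `u` is an initial factor of `w`, that is, `w = u * v` with lengths adding. -/
def Pre (u w : C.weyl) : Prop := len w = len u + len (u⁻¹ * w)

theorem pre_mul {u v : C.weyl} (h : len (u * v) = len u + len v) : Pre u (u * v) := by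
  rw [Pre, inv_mul_cancel_left, h]

theorem Pre.refl (u : C.weyl) : Pre u u := by simp [Pre]

theorem one_pre (u : C.weyl) : Pre 1 u := by simp [Pre]

theorem Pre.trans {u v w : C.weyl} (h1 : Pre u v) (h2 : Pre v w) : Pre u w := by
  have h3 := len_mul_le (u⁻¹ * v) (v⁻¹ * w)
  rw [mul_assoc, mul_inv_cancel_left] at h3
  have h4 := len_mul_le u (u⁻¹ * w)
  rw [mul_inv_cancel_left] at h4
  unfold Pre at *
  omega

theorem Pre.len_le {u v : C.weyl} (h : Pre u v) : len u ≤ len v := by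
  rw [h]; omega

theorem Pre.eq_of_len_le {u v : C.weyl} (h : Pre u v) (h' : len v ≤ len u) : u = v := by
  have : len (u⁻¹ * v) = 0 := by rw [Pre] at h; omega
  exact inv_mul_eq_one.1 (eq_one_of_len_eq_zero this)

theorem Pre.antisymm {u v : C.weyl} (h1 : Pre u v) (h2 : Pre v u) : u = v :=
  h1.eq_of_len_le h2.len_le

theorem Pre.len_mul {u y z : C.weyl} (h : Pre y z) (hz : len (u * z) = len u + len z) :
    len (u * y) = len u + len y := by
  have h1 := len_mul_le (u * y) (y⁻¹ * z)
  rw [mul_assoc, mul_inv_cancel_left] at h1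
  have h2 := len_mul_le u y
  unfold Pre at h
  omega

theorem Pre.mul_left {u y z : C.weyl} (h : Pre y z) (hz : len (u * z) = len u + len z) :
    Pre (u * y) (u * z) := by
  have h1 := h.len_mul hz
  unfold Pre at *
  rw [mul_inv_rev, mul_assoc, inv_mul_cancel_left]
  omega

theorem Pre.of_mul_left {u y z : C.weyl} (h : Pre (u * y) (u * z))
    (hy : len (u * y) = len u + len y) (hz : len (u * z) = len u + len z) : Pre y z := by
  unfold Pre at *
  rw [mul_inv_rev, mul_assoc, inv_mul_cancel_left] at h
  omega

theorem Pre.exists_step {y z : C.weyl} (h : Pre y z) (hne : y ≠ z) :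
    ∃ i, len (y * C.s i) = len y + 1 ∧ Pre (y * C.s i) z := by
  have hr := reduced_redWord (y⁻¹ * z)
  have hp := prod_redWord (y⁻¹ * z)
  rcases hl : redWord (y⁻¹ * z) with _ | ⟨i, l⟩
  · rw [hl] at hp
    exact absurd (inv_mul_eq_one.1 hp.symm) hne
  rw [hl] at hr hp
  have hr' := hr.of_cons
  rw [Reduced, hp, List.length_cons] at hr
  rw [Reduced] at hr'
  rw [List.map_cons, List.prod_cons] at hp
  have h1 : (y * C.s i)⁻¹ * z = (l.map C.s).prod := by
    rw [mul_inv_rev, mul_assoc, ← hp, inv_mul_cancel_left]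
  have h2 : y * C.s i * (l.map C.s).prod = z := by rw [← h1, mul_inv_cancel_left]
  have h3 := len_mul_le (y * C.s i) (l.map C.s).prod
  have h4 := len_mul_le y (C.s i)
  have h5 := len_s_le (C := C) i
  rw [h2] at h3
  unfold Pre at *
  refine ⟨i, ?_, ?_⟩
  · omega
  · rw [h1]; omega

/-- The initial factors `y` of `x` such that `u * y` adds lengths. -/
def CommonPre (u x y : C.weyl) : Prop := Pre y x ∧ len (u * y) = len u + len y

theorem CommonPre.of_pre {u x y z : C.weyl} (hz : CommonPre u x z) (h : Pre y z) :
    CommonPre u x y := ⟨h.trans hz.1, h.len_mul hz.2⟩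

theorem CommonPre.diamond (hs : C.Signed) {u x y : C.weyl} {i j : ι} (hij : i ≠ j)
    (hi : len (y * C.s i) = len y + 1) (hj : len (y * C.s j) = len y + 1)
    (hxi : CommonPre u x (y * C.s i)) (hxj : CommonPre u x (y * C.s j)) :
    ∃ d, CommonPre u x d ∧ Pre (y * C.s i) d ∧ Pre (y * C.s j) d := by
  have hyx : CommonPre u x y := hxi.of_pre (pre_mul (by rw [hi, len_s hs]))
  have desc : ∀ k, len (y * C.s k) = len y + 1 → CommonPre u x (y * C.s k) →
      ((y⁻¹ * x)⁻¹).1 (Finsupp.single k 1) ≤ 0 := fun k hk hxk => by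
    have h1 := hxk.1
    have h2 := hyx.1
    unfold Pre at h1 h2
    rw [mul_inv_rev, s_inv, mul_assoc] at h1
    rw [nonpos_iff_len hs, ← len_s_mul, len_inv]
    omega
  have hx := len_alt_inv_mul hs hij (desc i hi hxi) (desc j hj hxj)
  have hy := len_mul_alt_of_nonneg hs hij ((nonneg_iff_len hs).2 hi) ((nonneg_iff_len hs).2 hj)
    le_rfl
  have asc : ∀ k, len (y * C.s k) = len y + 1 → CommonPre u x (y * C.s k) →
      0 ≤ (u * y).1 (Finsupp.single k 1) := fun k hk hxk => by
    rw [nonneg_iff_len hs, mul_assoc, hxk.2, hyx.2, hk, add_assoc]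
  have hu := len_mul_alt_of_nonneg hs hij (asc i hi hxi) (asc j hj hxj) le_rfl
  obtain ⟨n, hn⟩ : ∃ n, C.m i j = n + 1 :=
    ⟨C.m i j - 1, by have := two_le_m (C := C) hij; omega⟩
  have pre : ∀ a b, a ≠ b → C.m a b = n + 1 → len (y * C.s a) = len y + 1 →
      len (y * alt (C.s a) (C.s b) (n + 1)) = len y + (n + 1) →
      Pre (y * C.s a) (y * alt (C.s a) (C.s b) (n + 1)) := fun a b hab hm ha h => by
    rw [alt, ← mul_assoc] at h ⊢
    refine pre_mul ?_
    rw [h, ha, len_alt hs hab.symm (by rw [m_symm]; omega)]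
    omega
  refine ⟨y * alt (C.s i) (C.s j) (C.m i j), ⟨?_, ?_⟩, ?_, ?_⟩
  · have := hyx.1
    unfold Pre at *
    rw [mul_inv_rev, mul_assoc, hy]
    omega
  · rw [← mul_assoc, hu, hyx.2, hy, add_assoc]
  · rw [hn] at hy ⊢
    exact pre i j hij hn hi hy
  · rw [alt_s] at hy ⊢
    rw [hn] at hy ⊢
    exact pre j i hij.symm (by rw [m_symm, hn]) hj hy

/-- Newman's lemma: by the diamond property, the initial factors of `x` whose product with `u` adds
lengths have a greatest element. -/
theorem exists_greatest_commonPre (hs : C.Signed) (u x : C.weyl) :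
    ∃ g, CommonPre u x g ∧ ∀ z, CommonPre u x z → Pre z g := by
  have key : ∀ (n : ℕ) (y : C.weyl), CommonPre u x y → len x ≤ len y + n →
      ∃ g, CommonPre u x g ∧ Pre y g ∧ ∀ z, CommonPre u x z → Pre y z → Pre z g := by
    intro n
    induction n with
    | zero =>
      intro y hy hn
      have hyx := hy.1.eq_of_len_le hn
      exact ⟨y, hy, Pre.refl y, fun z hz _ => hyx ▸ hz.1⟩
    | succ n ih =>
      intro y hy hn
      by_cases hstep : ∃ i, len (y * C.s i) = len y + 1 ∧ CommonPre u x (y * C.s i)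
      · obtain ⟨i, hi, hxi⟩ := hstep
        obtain ⟨g, hg, hig, hmax⟩ := ih (y * C.s i) hxi (by omega)
        refine ⟨g, hg, (pre_mul (by rw [hi, len_s hs])).trans hig, fun z hz hyz => ?_⟩
        rcases eq_or_ne y z with rfl | hne
        · exact (pre_mul (by rw [hi, len_s hs])).trans hig
        obtain ⟨j, hj, hjz⟩ := hyz.exists_step hne
        rcases eq_or_ne i j with rfl | hij
        · exact hmax z hz hjz
        have hxj := hz.of_pre hjz
        obtain ⟨g', hg', -, hmax'⟩ := ih (y * C.s j) hxj (by omega)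
        obtain ⟨d, hd, hid, hjd⟩ := CommonPre.diamond hs hij hi hj hxi hxj
        exact (hmax' z hz hjz).trans
          (hmax g' hg' (hid.trans (hmax' d hd hjd)))
      · refine ⟨y, hy, Pre.refl y, fun z hz hyz => ?_⟩
        rcases eq_or_ne y z with rfl | hne
        · exact Pre.refl y
        obtain ⟨j, hj, hjz⟩ := hyz.exists_step hne
        exact absurd ⟨j, hj, hz.of_pre hjz⟩ hstep
  obtain ⟨g, hg, -, hmax⟩ := key (len x) 1 ⟨one_pre x, by simp⟩ (by omega)
  exact ⟨g, hg, fun z hz => hmax z hz (one_pre z)⟩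

open Classical in
/-- The greatest initial factor `y` of `x` such that `u * y` adds lengths. It exists if `C` is
`Signed`; the value `1` in the other case is a junk value. -/
noncomputable def gcp (u x : C.weyl) : C.weyl :=
  if h : ∃ g, CommonPre u x g ∧ ∀ z, CommonPre u x z → Pre z g then h.choose else 1

theorem gcp_commonPre (hs : C.Signed) (u x : C.weyl) : CommonPre u x (gcp u x) := by
  rw [gcp, dif_pos (exists_greatest_commonPre hs u x)]
  exact (exists_greatest_commonPre hs u x).choose_spec.1

theorem pre_gcp (hs : C.Signed) {u x z : C.weyl} (h : CommonPre u x z) : Pre z (gcp u x) := by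
  rw [gcp, dif_pos (exists_greatest_commonPre hs u x)]
  exact (exists_greatest_commonPre hs u x).choose_spec.2 z h

theorem gcp_one (hs : C.Signed) (x : C.weyl) : gcp 1 x = x :=
  (gcp_commonPre hs 1 x).1.antisymm (pre_gcp hs ⟨Pre.refl x, by simp⟩)

theorem gcp_mul_pre_gcp (hs : C.Signed) (u v x : C.weyl) (h : len (u * v) = len u + len v) :
    Pre (gcp (u * v) x) (gcp v x) := by
  have hy' := gcp_commonPre hs (u * v) x
  refine pre_gcp hs ⟨hy'.1, ?_⟩
  have h1 := hy'.2
  have h2 := len_mul_le u (v * gcp (u * v) x)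
  have h3 := len_mul_le v (gcp (u * v) x)
  rw [mul_assoc] at h1
  omega

/-- The part of `x` absorbed by a product is computed in two steps, which makes `act` below an
action. -/
theorem gcp_mul (hs : C.Signed) {u v : C.weyl} (h : len (u * v) = len u + len v) (x : C.weyl) :
    gcp u (v * gcp v x) = v * gcp (u * v) x := by
  have hy := gcp_commonPre hs v x
  have hy' := gcp_commonPre hs (u * v) x
  have hyy' := gcp_mul_pre_gcp hs u v x h
  have hv' := hyy'.len_mul hy.2
  have h1 : CommonPre u (v * gcp v x) (v * gcp (u * v) x) := by
    refine ⟨hyy'.mul_left hy.2, ?_⟩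
    rw [← mul_assoc, hy'.2, h, hv', add_assoc]
  refine Pre.antisymm ?_ (pre_gcp hs h1)
  have hg := gcp_commonPre hs u (v * gcp v x)
  have hvg : Pre v (gcp u (v * gcp v x)) := pre_gcp hs ⟨pre_mul hy.2, h⟩
  obtain ⟨g, hgg⟩ : ∃ g, gcp u (v * gcp v x) = v * g := ⟨v⁻¹ * _, (mul_inv_cancel_left _ _).symm⟩
  rw [hgg] at hg hvg ⊢
  have hvg' : len (v * g) = len v + len g := by
    rw [Pre, inv_mul_cancel_left] at hvg; exact hvg
  refine Pre.mul_left (pre_gcp hs ⟨(hg.1.of_mul_left hvg' hy.2).trans hy.1, ?_⟩) hv'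
  rw [mul_assoc, hg.2, hvg', h, add_assoc]

/-! ### The greatest simple left divisor of a positive braid, and left cancellation -/

/-- The action of `u` on pairs `(x, c)`, which stand for the positive braids `T_x * c`: the largest
possible part of `x` is absorbed in the first factor. -/
noncomputable def act (u : C.weyl) : Function.End (C.weyl × C.BraidMonoid) :=
  fun p => (u * gcp u p.1, simple ((gcp u p.1)⁻¹ * p.1) * p.2)

theorem act_one (hs : C.Signed) : act (1 : C.weyl) = 1 := by
  funext p
  simp only [act, gcp_one hs, inv_mul_cancel, simple_one, one_mul]
  rfl

theorem act_mul (hs : C.Signed) (u v : C.weyl) (h : len (u * v) = len u + len v) :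
    act (u * v) = act u * act v := by
  funext p
  change _ = act u (act v p)
  simp only [act, gcp_mul hs h, mul_assoc, mul_inv_rev, inv_mul_cancel_left]
  congr 1
  rw [← mul_assoc (simple _), ← simple_mul hs, mul_assoc, mul_inv_cancel_left]
  have hy := gcp_commonPre hs v p.1
  have hy' := gcp_commonPre hs (u * v) p.1
  have hyy' := gcp_mul_pre_gcp hs u v p.1 h
  have h1 := hy.1
  have h2 := hy'.1
  rw [mul_assoc, mul_inv_cancel_left]
  unfold Pre at *
  omega

/-- The action of the braid monoid on pairs. -/
noncomputable def posAct (hs : C.Signed) :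
    C.BraidMonoid →* Function.End (C.weyl × C.BraidMonoid) :=
  posLift (fun i => act (C.s i)) (isBraided_of_mul hs (act_one hs) (act_mul hs))

/-- The factorization of a positive braid into its greatest simple left divisor and a remainder. -/
noncomputable def nf (hs : C.Signed) (b : C.BraidMonoid) : C.weyl × C.BraidMonoid :=
  posAct hs b (1, 1)

theorem posAct_pos (hs : C.Signed) (i : ι) : posAct hs (C.pos i) = act (C.s i) := posLift_pos ..

theorem posAct_simple (hs : C.Signed) (u : C.weyl) : posAct hs (simple u) = act u := by
  rw [simple, map_wordMap, ← wordMap_eq_of_mul hs (act_one hs) (act_mul hs) u]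
  exact congrArg (wordMap · u) (funext fun i => posAct_pos hs i)

theorem nf_simple_mul (hs : C.Signed) (u : C.weyl) (b : C.BraidMonoid) :
    nf hs (simple u * b) = act u (nf hs b) := by
  rw [nf, map_mul, posAct_simple]; rfl

theorem simple_nf (hs : C.Signed) (b : C.BraidMonoid) :
    simple (nf hs b).1 * (nf hs b).2 = b := by
  induction b using pos_induction with
  | one => rw [nf, map_one]; exact (mul_one _).trans simple_one
  | pos_mul i b ih =>
    have hg := gcp_commonPre hs (C.s i) (nf hs b).1
    rw [← simple_s hs, nf_simple_mul, act]
    dsimp only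
    rw [simple_mul hs hg.2, mul_assoc, ← mul_assoc (simple (gcp _ _)), ← simple_mul hs,
      mul_inv_cancel_left, ih]
    rw [mul_inv_cancel_left]
    exact hg.1

/-- The first factor of the normal form is above every simple left divisor. -/
theorem pre_nf_of_simple_mul (hs : C.Signed) (w : C.weyl) (c : C.BraidMonoid) :
    Pre w (nf hs (simple w * c)).1 := by
  rw [nf_simple_mul]
  exact pre_mul (gcp_commonPre hs w _).2

theorem simple_mul_left_cancel (hs : C.Signed) {u : C.weyl} {b c : C.BraidMonoid}
    (h : simple u * b = simple u * c) : b = c := by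
  -- the factorizations of both products determine the same `y`, and equal remainders `T_z * ω`
  have h1 := congrArg (nf hs) h
  rw [nf_simple_mul, nf_simple_mul, act, act, Prod.mk.injEq] at h1
  obtain ⟨h1, h2⟩ := h1
  have key : ∀ b, b = simple (gcp u (nf hs b).1) *
      (simple ((gcp u (nf hs b).1)⁻¹ * (nf hs b).1) * (nf hs b).2) := fun b => by
    rw [← mul_assoc, ← simple_mul hs, mul_inv_cancel_left, simple_nf]
    rw [mul_inv_cancel_left]
    exact (gcp_commonPre hs u _).1
  rw [key b, key c, h2, mul_left_cancel h1]

theorem pos_mul_left_cancel (hs : C.Signed) {a b c : C.BraidMonoid} (h : a * b = a * c) :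
    b = c := by
  induction a using pos_induction with
  | one => rwa [one_mul, one_mul] at h
  | pos_mul i a ih =>
    rw [mul_assoc, mul_assoc, ← simple_s hs] at h
    exact ih (simple_mul_left_cancel hs h)

/-! ### The longest element and the Garside element -/

theorem apply_nonpos_of_nonneg {w : C.weyl} (hw : ∀ i, w.1 (Finsupp.single i 1) ≤ 0)
    {x : ι →₀ ℤ} (hx : 0 ≤ x) : w.1 x ≤ 0 := by
  have h : x = ∑ j, x j • Finsupp.single j 1 := by
    conv_lhs => rw [← Finsupp.univ_sum_single x]
    simp
  rw [h, map_sum]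
  refine Finset.sum_nonpos fun j _ => ?_
  rw [map_zsmul]
  exact smul_nonpos_of_nonneg_of_nonpos (hx j) (hw j)

/-- The longest element: multiplying it by any element subtracts lengths. -/
theorem exists_longest (hs : C.Signed) [Finite C.weyl] :
    ∃ w₀ : C.weyl, ∀ u, len (w₀ * u) + len u = len w₀ := by
  obtain ⟨w₀, h₀⟩ := Finite.exists_max (len : C.weyl → ℕ)
  have hneg : ∀ i, w₀.1 (Finsupp.single i 1) ≤ 0 := fun i =>
    (hs w₀ i).resolve_left fun h => by
      have h1 := h₀ (w₀ * C.s i)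
      rw [len_mul_s_of_nonneg hs h] at h1
      omega
  have key : ∀ l : List ι, C.Reduced l →
      len (w₀ * (l.map C.s).prod) + len (l.map C.s).prod = len w₀ := by
    intro l
    induction l using List.reverseRecOn with
    | nil => intro _; simp
    | append_singleton l i ih =>
      intro hl
      have hp : ((l ++ [i]).map C.s).prod = (l.map C.s).prod * C.s i := by simp
      rw [Reduced, hp, List.length_append, List.length_singleton] at hl
      have h1 := len_le (C := C) _ l rfl
      have h2 := len_mul_le (l.map C.s).prod (C.s i)
      have h3 := len_s_le (C := C) i
      have hpos := (nonneg_iff_len hs (w := (l.map C.s).prod) (i := i)).2 (by omega)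
      have h4 := len_mul_s_of_nonpos hs (w := w₀ * (l.map C.s).prod) (i := i)
        (by rw [mul_apply]; exact apply_nonpos_of_nonneg hneg hpos)
      have h5 := ih (show l.length = _ by omega)
      rw [hp, ← mul_assoc]
      omega
  exact ⟨w₀, fun u => by have := key _ (reduced_redWord u); rwa [prod_redWord] at this⟩

section longest

variable {w₀ : C.weyl}

theorem longest_mul_self (h₀ : ∀ u, len (w₀ * u) + len u = len w₀) : w₀ * w₀ = 1 :=
  eq_one_of_len_eq_zero (by have := h₀ w₀; omega)

theorem len_mul_longest (h₀ : ∀ u, len (w₀ * u) + len u = len w₀) (u : C.weyl) :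
    len (u * w₀) + len u = len w₀ := by
  rw [← h₀ u⁻¹, ← len_inv, mul_inv_rev, inv_eq_of_mul_eq_one_left (longest_mul_self h₀), len_inv u]

theorem exists_simple_longest_eq_mul (hs : C.Signed) (h₀ : ∀ u, len (w₀ * u) + len u = len w₀)
    (i : ι) : ∃ c, simple w₀ = C.pos i * c := by
  have h := len_mul_longest h₀ (C.s i)
  refine ⟨simple (C.s i * w₀), ?_⟩
  rw [← simple_s hs, ← simple_mul hs, s_mul_s_mul]
  rw [s_mul_s_mul]
  omega

/-- Conjugation by the longest element permutes the simple reflections. -/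
theorem exists_longest_mul_s (hs : C.Signed) (h₀ : ∀ u, len (w₀ * u) + len u = len w₀) (i : ι) :
    ∃ j, w₀ * C.s i = C.s j * w₀ := by
  have h1 := h₀ (C.s i * w₀)
  have h2 := len_mul_longest h₀ (C.s i)
  rw [len_s hs] at h2
  have hr := length_redWord (w₀ * (C.s i * w₀))
  have hp := prod_redWord (w₀ * (C.s i * w₀))
  obtain ⟨j, hj⟩ := List.length_eq_one_iff.1 (hr.trans (by omega))
  rw [hj] at hp
  refine ⟨j, ?_⟩
  rw [List.map_singleton, List.prod_singleton] at hp
  rw [hp, mul_assoc, mul_assoc, longest_mul_self h₀, mul_one]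

theorem simple_longest_mul_pos (hs : C.Signed) (h₀ : ∀ u, len (w₀ * u) + len u = len w₀)
    {i j : ι} (h : w₀ * C.s i = C.s j * w₀) :
    simple w₀ * C.pos i = C.pos j * simple w₀ := by
  have h1 := len_mul_longest h₀ (C.s j)
  have h2 := h₀ (C.s i)
  have e1 : simple w₀ = C.pos j * simple (C.s j * w₀) := by
    rw [← simple_s hs, ← simple_mul hs, s_mul_s_mul]
    rw [s_mul_s_mul]; omega
  have e2 : simple w₀ = simple (w₀ * C.s i) * C.pos i := by
    rw [← simple_s hs, ← simple_mul hs, mul_s_mul_s]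
    rw [mul_s_mul_s]; omega
  conv_lhs => rw [e1]
  conv_rhs => rw [e2]
  rw [h, mul_assoc]

theorem garside_central (hs : C.Signed) (h₀ : ∀ u, len (w₀ * u) + len u = len w₀)
    (b : C.BraidMonoid) : simple w₀ * simple w₀ * b = b * (simple w₀ * simple w₀) := by
  induction b using pos_induction with
  | one => rw [one_mul, mul_one]
  | pos_mul i b ih =>
    obtain ⟨j, hj⟩ := exists_longest_mul_s hs h₀ i
    have hj' : w₀ * C.s j = C.s i * w₀ := by
      have h1 := longest_mul_self h₀
      calc w₀ * C.s j = w₀ * (C.s j * w₀) * w₀ := by rw [mul_assoc, mul_assoc, h1, mul_one]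
        _ = C.s i * w₀ := by rw [← hj, ← mul_assoc, h1, one_mul]
    rw [mul_assoc (C.pos i), ← ih, ← mul_assoc, ← mul_assoc, mul_assoc _ _ (C.pos i),
      simple_longest_mul_pos hs h₀ hj, ← mul_assoc, simple_longest_mul_pos hs h₀ hj',
      mul_assoc (C.pos i)]

theorem exists_garside_eq (hs : C.Signed) (h₀ : ∀ u, len (w₀ * u) + len u = len w₀) (i : ι) :
    ∃ c, C.pos i * c = simple w₀ * simple w₀ ∧ c * C.pos i = simple w₀ * simple w₀ := by
  obtain ⟨c, hc⟩ := exists_simple_longest_eq_mul hs h₀ i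
  have h1 : C.pos i * (c * simple w₀) = simple w₀ * simple w₀ := by rw [← mul_assoc, ← hc]
  refine ⟨c * simple w₀, h1, pos_mul_left_cancel hs (a := C.pos i) ?_⟩
  rw [← mul_assoc, h1, garside_central hs h₀]

end longest

/-! ### The braid monoid embeds in the braid group -/

/-- A family in a group that satisfies the braid relations extends to the braid group. -/
noncomputable def braidLift {G : Type*} [Group G] (f : ι → G) (hf : C.IsBraided f) :
    C.Braid →* G :=
  PresentedGroup.toGroup (f := f) (by
    rintro _ ⟨⟨i, j⟩, rfl⟩
    rw [map_mul, map_inv, map_alt, map_alt, mul_inv_eq_one, FreeGroup.lift_apply_of,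
      FreeGroup.lift_apply_of]
    exact hf i j)

theorem braidLift_T {G : Type*} [Group G] (f : ι → G) (hf : C.IsBraided f) (i : ι) :
    braidLift f hf (C.T i) = f i := PresentedGroup.toGroup.of _

variable (C) in
theorem isBraided_T : C.IsBraided C.T := C.braid_relation

variable (C) in
/-- The homomorphism from the monoid of positive braids to the braid group. -/
noncomputable def toBraid : C.BraidMonoid →* C.Braid := posLift C.T C.isBraided_T

theorem toBraid_pos (i : ι) : C.toBraid (C.pos i) = C.T i := posLift_pos ..

theorem toBraid_simple (w : C.weyl) : C.toBraid (simple w) = wordMap C.T w := by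
  rw [simple, map_wordMap]
  exact congrArg (wordMap · w) (funext toBraid_pos)

theorem hom_ext {G : Type*} [Monoid G] {f g : C.BraidMonoid →* G}
    (h : ∀ i, f (C.pos i) = g (C.pos i)) : f = g := PresentedMonoid.ext _ h

/-- The Ore condition for the powers of a central element. -/
@[reducible] def oreSetOfCentral {M : Type*} [Monoid M] (z : M) (hz : ∀ b, z * b = b * z) :
    OreLocalization.OreSet (Submonoid.powers z) :=
  have hS : ∀ (s : Submonoid.powers z) (b : M), (s : M) * b = b * s := by
    rintro ⟨_, n, rfl⟩ b
    exact ((show Commute z b from hz b).pow_left n).eq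
  { ore_right_cancel := fun r₁ r₂ s h => ⟨s, by rw [hS, h, hS]⟩
    oreNum := fun r _ => r
    oreDenom := fun _ s => s
    ore_eq := fun r s => hS s r }

/-- Inverting a central multiple of all the generators maps the left cancellative monoid of positive
braids injectively to a monoid in which the generators are units. -/
theorem toBraid_injective (hs : C.Signed) [Finite C.weyl] : Function.Injective C.toBraid := by
  obtain ⟨w₀, h₀⟩ := exists_longest hs
  set z := simple w₀ * simple w₀ with hz
  let _ := oreSetOfCentral z (garside_central hs h₀)
  let S := Submonoid.powers z
  let num : C.BraidMonoid →* OreLocalization S C.BraidMonoid := OreLocalization.numeratorHom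
  have hzu : IsUnit (num z) := OreLocalization.numerator_isUnit (⟨z, 1, pow_one z⟩ : S)
  have hu : ∀ i, IsUnit (num (C.pos i)) := fun i => by
    obtain ⟨c, hc1, hc2⟩ := exists_garside_eq hs h₀ i
    obtain ⟨u, hu⟩ := hzu
    refine isUnit_iff_exists_and_exists.2 ⟨⟨num c * ↑u⁻¹, ?_⟩, ⟨↑u⁻¹ * num c, ?_⟩⟩
    · rw [← mul_assoc, ← map_mul, hc1, ← hu, Units.mul_inv]
    · rw [mul_assoc, ← map_mul, hc2, ← hu, Units.inv_mul]
  let f : ι → (OreLocalization S C.BraidMonoid)ˣ := fun i => (hu i).unit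
  have hf : C.IsBraided f := fun i j => by
    apply Units.ext
    have h := congrArg num (C.isBraided_pos i j)
    rw [map_alt, map_alt] at h
    have e := map_alt (Units.coeHom (OreLocalization S C.BraidMonoid)) (C.m i j)
    exact (e (f i) (f j)).trans (h.trans (e (f j) (f i)).symm)
  have hcomp : (Units.coeHom _).comp ((braidLift f hf).comp C.toBraid) = num :=
    hom_ext fun i => by
      rw [MonoidHom.comp_apply, MonoidHom.comp_apply, toBraid_pos, braidLift_T]
      rfl
  intro b c h
  have hnum : num b = num c := by
    rw [← hcomp, MonoidHom.comp_apply, MonoidHom.comp_apply, h]; rfl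
  obtain ⟨u, v, h1, h2⟩ := OreLocalization.oreDiv_eq_iff.1 hnum
  have huv : (u : C.BraidMonoid) = v := by simpa using h2
  rw [← huv] at h1
  exact (pos_mul_left_cancel hs h1).symm

/-- Every braid becomes positive after multiplication by a power of the central element. -/
theorem exists_pow_mul_eq (hs : C.Signed) {w₀ : C.weyl}
    (h₀ : ∀ u, len (w₀ * u) + len u = len w₀) (x : C.Braid) :
    ∃ (k : ℕ) (b : C.BraidMonoid), C.toBraid (simple w₀ * simple w₀) ^ k * x = C.toBraid b := by
  set z := simple w₀ * simple w₀ with hz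
  obtain ⟨x, rfl⟩ := PresentedGroup.mk_surjective _ x
  induction x using FreeGroup.induction_on with
  | C1 => exact ⟨0, 1, by simp⟩
  | of i => exact ⟨0, C.pos i, by rw [pow_zero, one_mul, toBraid_pos]; rfl⟩
  | inv_of i _ =>
    obtain ⟨c, -, hc⟩ := exists_garside_eq hs h₀ i
    refine ⟨1, c, ?_⟩
    rw [← hz] at hc
    rw [pow_one, map_inv, mul_inv_eq_iff_eq_mul, ← hc, map_mul, toBraid_pos]
    rfl
  | mul x y hx hy =>
    obtain ⟨k, b, hb⟩ := hx
    obtain ⟨n, c, hc⟩ := hy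
    refine ⟨n + k, b * c, ?_⟩
    have hcomm : Commute (C.toBraid z) (C.toBraid b) := by
      rw [Commute, SemiconjBy, ← map_mul, garside_central hs h₀, map_mul]
    rw [map_mul (PresentedGroup.mk _), map_mul C.toBraid b c, ← hc, ← mul_assoc (C.toBraid b),
      ← (hcomm.pow_left n).eq, ← hb, pow_add]
    simp only [mul_assoc]

variable {σ : Equiv.Perm ι}

/-! ### Products over sets of orthogonal vertices -/

theorem linearCombination_eq_sum (i : ι) (v : ι →₀ ℤ) :
    Finsupp.linearCombination ℤ (C.A i) v = ∑ k, v k * C.A i k := by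
  rw [Finsupp.linearCombination_apply, Finsupp.sum_fintype _ _ (by simp)]
  rfl

variable (C) in
/-- The letters of `l` are distinct and pairwise orthogonal. -/
def Orthogonal (l : List ι) : Prop := l.Nodup ∧ ∀ i ∈ l, ∀ j ∈ l, i ≠ j → C.A i j = 0

theorem Orthogonal.of_cons {i : ι} {l : List ι} (h : C.Orthogonal (i :: l)) : C.Orthogonal l :=
  ⟨(List.nodup_cons.1 h.1).2, fun _ ha _ hb =>
    h.2 _ (List.mem_cons_of_mem _ ha) _ (List.mem_cons_of_mem _ hb)⟩

theorem Orthogonal.mul_s_apply {i j : ι} {l : List ι} (h : C.Orthogonal (i :: l)) (hj : j ∈ l)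
    (w : C.weyl) : (w * C.s i).1 (Finsupp.single j 1) = w.1 (Finsupp.single j 1) := by
  rw [mul_apply]
  change w.1 (C.reflection i _) = _
  have hij : i ≠ j := by rintro rfl; exact (List.nodup_cons.1 h.1).1 hj
  rw [reflection_single, h.2 i List.mem_cons_self j (List.mem_cons_of_mem _ hj) hij, zero_smul,
    sub_zero]

theorem Orthogonal.len_mul_of_nonneg (hs : C.Signed) {l : List ι} (h : C.Orthogonal l) :
    ∀ w : C.weyl, (∀ i ∈ l, 0 ≤ w.1 (Finsupp.single i 1)) →
      len (w * (l.map C.s).prod) = len w + l.length := by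
  induction l with
  | nil => intro w _; simp
  | cons i l ih =>
    intro w hw
    rw [List.map_cons, List.prod_cons, ← mul_assoc, ih h.of_cons,
      len_mul_s_of_nonneg hs (hw i List.mem_cons_self), List.length_cons, add_assoc, add_comm 1]
    intro j hj
    rw [h.mul_s_apply hj]
    exact hw j (List.mem_cons_of_mem _ hj)

theorem Orthogonal.len_mul_of_nonpos (hs : C.Signed) {l : List ι} (h : C.Orthogonal l) :
    ∀ w : C.weyl, (∀ i ∈ l, w.1 (Finsupp.single i 1) ≤ 0) →
      len (w * (l.map C.s).prod) + l.length = len w := by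
  induction l with
  | nil => intro w _; simp
  | cons i l ih =>
    intro w hw
    rw [List.map_cons, List.prod_cons, ← mul_assoc,
      ← len_mul_s_of_nonpos hs (hw i List.mem_cons_self), List.length_cons, ← add_assoc,
      ih h.of_cons]
    intro j hj
    rw [h.mul_s_apply hj]
    exact hw j (List.mem_cons_of_mem _ hj)

theorem Orthogonal.reduced (hs : C.Signed) {l : List ι} (h : C.Orthogonal l) : C.Reduced l := by
  have := h.len_mul_of_nonneg hs 1 fun i _ => by change 0 ≤ Finsupp.single i 1; simp
  rw [one_mul, len_one, zero_add] at this
  exact this.symm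

open Classical in
theorem Orthogonal.prod_apply {l : List ι} (h : C.Orthogonal l) (v : ι →₀ ℤ) (k : ι) :
    (l.map C.s).prod.1 v k =
      v k - if k ∈ l then Finsupp.linearCombination ℤ (C.A k) v else 0 := by
  induction l generalizing k with
  | nil => simp
  | cons i l ih =>
    have ih := ih h.of_cons
    rw [List.map_cons, List.prod_cons, mul_apply]
    change C.reflection i _ k = _
    have hi := (List.nodup_cons.1 h.1).1
    rcases eq_or_ne k i with rfl | hk
    · rw [reflection_apply, Finsupp.sub_apply, Finsupp.smul_apply, Finsupp.single_eq_same, ih k,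
        if_neg hi, if_pos List.mem_cons_self, sub_zero, smul_eq_mul, mul_one,
        linearCombination_eq_sum, linearCombination_eq_sum]
      congr 1
      refine Finset.sum_congr rfl fun j _ => ?_
      rw [ih j]
      split_ifs with hj
      · rw [h.2 k List.mem_cons_self j (List.mem_cons_of_mem _ hj)
          (by rintro rfl; exact hi hj), mul_zero, mul_zero]
      · rw [sub_zero]
    · rw [C.reflection_apply_of_ne hk, ih k]
      simp [hk]

/-! ### The orbit elements -/

variable (σ) in
/-- The orbit `O_r` as a list. -/
noncomputable def orbitList (r : Orbits σ) : List ι := (Orbits.toFinset σ r).toList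

theorem mem_orbitList {r : Orbits σ} {i : ι} : i ∈ orbitList σ r ↔ Orbits.mk σ i = r := by
  simp [orbitList]

theorem orthogonal_orbitList (hσ : C.IsAdmissible σ) (r : Orbits σ) :
    C.Orthogonal (orbitList σ r) :=
  ⟨Finset.nodup_toList _, fun _ hi _ hj hij =>
    hσ.eq_zero ((mem_orbitList.1 hi).trans (mem_orbitList.1 hj).symm) hij⟩

theorem length_orbitList_pos (r : Orbits σ) : 0 < (orbitList σ r).length :=
  List.length_pos_of_mem (mem_orbitList.2 (Orbits.mk_rep r))

theorem noncommProd_eq_prod_toList {X G : Type*} [Monoid G] (J : Finset X) (f : X → G) (h) :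
    J.noncommProd f h = (J.toList.map f).prod := by
  have key : ∀ (S : Multiset X) (hS : Multiset.map f J.1 = Multiset.map f S), S = J.1 →
      (S.map f).noncommProd (hS ▸ Finset.noncommProd_lemma J f h) = J.noncommProd f h := by
    rintro S hS rfl
    rfl
  rw [← key (J.toList : Multiset X) (by rw [Finset.coe_toList]) (Finset.coe_toList J)]
  exact Multiset.noncommProd_coe _ _

theorem sHat_eq (hσ : C.IsAdmissible σ) (r : Orbits σ) :
    sHat hσ r = ((orbitList σ r).map C.s).prod := noncommProd_eq_prod_toList _ _ _

theorem THat_eq (hs : C.Signed) (hσ : C.IsAdmissible σ) (r : Orbits σ) :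
    THat hσ r = wordMap C.T (sHat hσ r) := by
  rw [sHat_eq, ← prod_map_eq_wordMap hs C.isBraided_T ((orthogonal_orbitList hσ r).reduced hs)]
  exact noncommProd_eq_prod_toList _ _ _

theorem len_sHat (hs : C.Signed) (hσ : C.IsAdmissible σ) (r : Orbits σ) :
    len (sHat hσ r) = (orbitList σ r).length := by
  rw [sHat_eq]; exact ((orthogonal_orbitList hσ r).reduced hs).symm

/-- If all vertices of an orbit are left descents of `w`, then `ŝ_r` is an initial factor. -/
theorem sHat_pre (hs : C.Signed) (hσ : C.IsAdmissible σ) {r : Orbits σ} {w : C.weyl}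
    (h : ∀ i, Orbits.mk σ i = r → (w⁻¹).1 (Finsupp.single i 1) ≤ 0) : Pre (sHat hσ r) w := by
  have := (orthogonal_orbitList hσ r).len_mul_of_nonpos hs w⁻¹ fun i hi => h i (mem_orbitList.1 hi)
  rw [← sHat_eq hσ, ← len_sHat hs hσ, len_inv, ← len_inv, mul_inv_rev, inv_inv] at this
  rw [Pre]
  omega

/-! ### The sublattice of fixed vectors -/

variable (σ) in
/-- The embedding `α_r ↦ ∑ i ∈ O_r, α_i` of the folded root lattice in the root lattice. -/
noncomputable def fold : (Orbits σ →₀ ℤ) →ₗ[ℤ] (ι →₀ ℤ) where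
  toFun x := Finsupp.equivFunOnFinite.symm fun i => x (Orbits.mk σ i)
  map_add' x y := by ext; simp
  map_smul' c x := by ext; simp

@[simp] theorem fold_apply (x : Orbits σ →₀ ℤ) (i : ι) : fold σ x i = x (Orbits.mk σ i) := rfl

theorem fold_injective : Function.Injective (fold σ) := fun x y h => by
  ext r
  have := DFunLike.congr_fun h (Orbits.rep σ r)
  rwa [fold_apply, fold_apply, Orbits.mk_rep] at this

theorem fold_nonneg {x : Orbits σ →₀ ℤ} : 0 ≤ fold σ x ↔ 0 ≤ x :=
  ⟨fun h r => by have := h (Orbits.rep σ r); rwa [fold_apply, Orbits.mk_rep] at this,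
    fun h i => h _⟩

theorem fold_nonpos {x : Orbits σ →₀ ℤ} : fold σ x ≤ 0 ↔ x ≤ 0 :=
  ⟨fun h r => by have := h (Orbits.rep σ r); rwa [fold_apply, Orbits.mk_rep] at this,
    fun h i => h _⟩

theorem fold_single (r : Orbits σ) :
    fold σ (Finsupp.single r 1) = ∑ i ∈ Orbits.toFinset σ r, Finsupp.single i 1 := by
  classical
  ext k
  simp only [fold_apply, Finsupp.single_apply, Finsupp.finsetSum_apply, Finset.sum_ite_eq',
    Orbits.mem_toFinset]
  simp only [eq_comm]

/-- On the sublattice of fixed vectors, `ŝ_r` acts as the simple reflection of the dual of the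
folded Cartan matrix. -/
theorem sHat_fold (hC : C.A.IsSimplyLaced) (hσ : C.IsAdmissible σ) (r : Orbits σ)
    (x : Orbits σ →₀ ℤ) :
    (sHat hσ r).1 (fold σ x) = fold σ (((dualFold hC hσ).s r).1 x) := by
  classical
  ext k
  rw [sHat_eq, (orthogonal_orbitList hσ r).prod_apply, fold_apply, fold_apply]
  change _ = (dualFold hC hσ).reflection r x _
  rw [reflection_apply, Finsupp.sub_apply, Finsupp.smul_apply, smul_eq_mul]
  congr 1
  by_cases hk : Orbits.mk σ k = r
  · subst hk
    rw [if_pos (mem_orbitList.2 rfl), Finsupp.single_eq_same, mul_one, linearCombination_eq_sum,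
      linearCombination_eq_sum, Orbits.sum_eq (σ := σ)]
    refine Finset.sum_congr rfl fun t _ => ?_
    change _ = x t * C.foldedMatrix σ t (Orbits.mk σ k)
    rw [foldedMatrix_apply hσ, Finset.mul_sum]
    refine Finset.sum_congr rfl fun i hi => ?_
    rw [fold_apply, Orbits.mem_toFinset.1 hi, C.isSymm_of_simplyLaced hC]
  · rw [if_neg (fun h => hk (mem_orbitList.1 h)), Finsupp.single_apply, if_neg (Ne.symm hk),
      mul_zero]

/-! ### Elements of the Weyl group fixed by the diagram automorphism -/

theorem weylAut_apply_single (hσ : C.IsAdmissible σ) (w : C.weyl) (i : ι) :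
    (weylAut hσ w).1 (Finsupp.single (σ i) 1) = latticePerm σ (w.1 (Finsupp.single i 1)) := by
  change latticePerm σ (w.1 ((latticePerm σ).symm (Finsupp.single (σ i) 1))) = _
  rw [latticePerm_symm_single, Equiv.symm_apply_apply]

/-- A property of vertices that is stable under `σ` holds on whole orbits. -/
theorem orbit_induction {p : ι → Prop} (hp : ∀ i, p i → p (σ i)) {i j : ι}
    (h : Orbits.mk σ i = Orbits.mk σ j) (hi : p i) : p j := by
  have hc : σ.SameCycle i j := Orbits.mk_eq_iff.1 h
  obtain ⟨n, -, rfl⟩ := hc.exists_pow_eq'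
  clear h hc
  induction n with
  | zero => exact hi
  | succ n ih => rw [pow_succ', Equiv.Perm.mul_apply]; exact hp _ ih

theorem nonneg_orbit (hσ : C.IsAdmissible σ) {w : C.weyl} (hw : weylAut hσ w = w) {i j : ι}
    (h : Orbits.mk σ i = Orbits.mk σ j) (hi : 0 ≤ w.1 (Finsupp.single i 1)) :
    0 ≤ w.1 (Finsupp.single j 1) := by
  refine orbit_induction (p := fun i => 0 ≤ w.1 (Finsupp.single i 1)) (fun i hi => ?_) h hi
  rw [← hw, weylAut_apply_single]
  exact fun k => hi _

theorem nonpos_orbit (hσ : C.IsAdmissible σ) {w : C.weyl} (hw : weylAut hσ w = w) {i j : ι}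
    (h : Orbits.mk σ i = Orbits.mk σ j) (hi : w.1 (Finsupp.single i 1) ≤ 0) :
    w.1 (Finsupp.single j 1) ≤ 0 := by
  refine orbit_induction (p := fun i => w.1 (Finsupp.single i 1) ≤ 0) (fun i hi => ?_) h hi
  rw [← hw, weylAut_apply_single]
  exact fun k => hi _

theorem apply_fold_nonneg (hσ : C.IsAdmissible σ) {w : C.weyl} (hw : weylAut hσ w = w) {i : ι}
    (hi : 0 ≤ w.1 (Finsupp.single i 1)) :
    0 ≤ w.1 (fold σ (Finsupp.single (Orbits.mk σ i) 1)) := by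
  rw [fold_single, map_sum]
  exact Finset.sum_nonneg fun j hj => nonneg_orbit hσ hw (Orbits.mem_toFinset.1 hj).symm hi

theorem apply_fold_nonpos (hσ : C.IsAdmissible σ) {w : C.weyl} (hw : weylAut hσ w = w) {i : ι}
    (hi : w.1 (Finsupp.single i 1) ≤ 0) :
    w.1 (fold σ (Finsupp.single (Orbits.mk σ i) 1)) ≤ 0 := by
  rw [fold_single, map_sum]
  exact Finset.sum_nonpos fun j hj => nonpos_orbit hσ hw (Orbits.mem_toFinset.1 hj).symm hi

theorem eq_one_of_nonneg (hs : C.Signed) {w : C.weyl}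
    (h : ∀ i, 0 ≤ w.1 (Finsupp.single i 1)) : w = 1 := by
  by_contra hne
  obtain ⟨i, h1, h2⟩ := (one_pre w⁻¹).exists_step (fun h => hne (inv_eq_one.1 h.symm))
  rw [one_mul, Pre, s_inv, len_s_mul, inv_inv, len_inv, len_s hs] at h2
  have := len_mul_s_of_nonneg hs (h i)
  omega

theorem exists_left_descent (hs : C.Signed) {w : C.weyl} (hw : w ≠ 1) :
    ∃ i, (w⁻¹).1 (Finsupp.single i 1) ≤ 0 := by
  by_contra! h
  exact hw (inv_eq_one.1 (eq_one_of_nonneg hs fun i => (hs _ i).resolve_right (h i)))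

/-- A fixed element of the Weyl group is determined by its action on the fixed vectors. -/
theorem eq_one_of_fold (hs : C.Signed) (hσ : C.IsAdmissible σ) {w : C.weyl}
    (hw : weylAut hσ w = w) (h : ∀ x, w.1 (fold σ x) = fold σ x) : w = 1 := by
  refine eq_one_of_nonneg hs fun i => (hs w i).resolve_right fun hi => ?_
  have h1 := apply_fold_nonpos hσ hw hi
  rw [h, fold_nonpos] at h1
  have := h1 (Orbits.mk σ i)
  simp at this

theorem eq_of_fold (hs : C.Signed) (hσ : C.IsAdmissible σ) {u v : C.weyl}
    (hu : weylAut hσ u = u) (hv : weylAut hσ v = v)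
    (h : ∀ x, u.1 (fold σ x) = v.1 (fold σ x)) : u = v := by
  rw [← inv_mul_eq_one]
  refine eq_one_of_fold hs hσ (by rw [map_mul, map_inv, hu, hv]) fun x => ?_
  rw [mul_apply, ← h, inv_apply_self]

theorem weylAut_prod_map_s (hσ : C.IsAdmissible σ) (l : List ι) :
    weylAut hσ (l.map C.s).prod = ((l.map σ).map C.s).prod := by
  rw [map_list_prod, List.map_map, List.map_map]
  exact congrArg (fun f => (l.map f).prod) (funext fun i => weylAut_s hσ i)

theorem len_weylAut (hσ : C.IsAdmissible σ) (w : C.weyl) : len (weylAut hσ w) = len w := by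
  apply le_antisymm
  · refine (len_le _ ((redWord w).map σ) ?_).trans_eq (List.length_map _)
    rw [← weylAut_prod_map_s, prod_redWord]
  · refine (len_le _ ((redWord (weylAut hσ w)).map σ.symm) ?_).trans_eq (List.length_map _)
    apply (weylAut hσ).injective
    rw [weylAut_prod_map_s, List.map_map (f := σ.symm), Equiv.self_comp_symm, List.map_id,
      prod_redWord]

theorem weylAut_sHat (hσ : C.IsAdmissible σ) (r : Orbits σ) :
    weylAut hσ (sHat hσ r) = sHat hσ r := by
  have h : C.Orthogonal ((orbitList σ r).map σ) := by
    refine ⟨(Finset.nodup_toList _).map σ.injective, fun i' hi' j' hj' hij => ?_⟩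
    obtain ⟨i, hi, rfl⟩ := List.mem_map.1 hi'
    obtain ⟨j, hj, rfl⟩ := List.mem_map.1 hj'
    rw [hσ.map_eq]
    exact (orthogonal_orbitList hσ r).2 i hi j hj fun h => hij (congrArg σ h)
  have hmem : ∀ k, k ∈ (orbitList σ r).map σ ↔ k ∈ orbitList σ r := fun k => by
    rw [List.mem_map, mem_orbitList]
    constructor
    · rintro ⟨i, hi, rfl⟩
      rw [Orbits.mk_apply]
      exact mem_orbitList.1 hi
    · intro hk
      refine ⟨σ.symm k, ?_, Equiv.apply_symm_apply _ _⟩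
      rw [mem_orbitList, ← Orbits.mk_apply, Equiv.apply_symm_apply, hk]
  rw [sHat_eq, weylAut_prod_map_s]
  apply Subtype.ext
  apply LinearEquiv.ext
  intro v
  ext k
  rw [h.prod_apply, (orthogonal_orbitList hσ r).prod_apply]
  by_cases hk : k ∈ orbitList σ r
  · rw [if_pos hk, if_pos ((hmem k).2 hk)]
  · rw [if_neg hk, if_neg (fun h => hk ((hmem k).1 h))]

/-! ### The isomorphism of Weyl groups -/

section hat

variable (hC : C.A.IsSimplyLaced) (hσ : C.IsAdmissible σ)

/-- The element `ŵ` of the Weyl group of `C` that corresponds to the element `w` of the Weyl group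
of the dual of the folded Cartan matrix, as the product of the `ŝ_r` along a reduced word. -/
noncomputable def hat (w : (dualFold hC hσ).weyl) : C.weyl := wordMap (sHat hσ) w

theorem weylAut_prod_sHat (l : List (Orbits σ)) :
    weylAut hσ (l.map (sHat hσ)).prod = (l.map (sHat hσ)).prod := by
  rw [map_list_prod, List.map_map]
  exact congrArg (fun f => (l.map f).prod) (funext fun r => weylAut_sHat hσ r)

theorem prod_sHat_fold (l : List (Orbits σ)) (x : Orbits σ →₀ ℤ) :
    (l.map (sHat hσ)).prod.1 (fold σ x) = fold σ ((l.map (dualFold hC hσ).s).prod.1 x) := by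
  induction l with
  | nil => rfl
  | cons r l ih =>
    rw [List.map_cons, List.prod_cons, mul_apply, ih, sHat_fold hC, List.map_cons, List.prod_cons,
      mul_apply]

theorem weylAut_hat (w : (dualFold hC hσ).weyl) : weylAut hσ (hat hC hσ w) = hat hC hσ w :=
  weylAut_prod_sHat hσ _

theorem hat_fold (w : (dualFold hC hσ).weyl) (x : Orbits σ →₀ ℤ) :
    (hat hC hσ w).1 (fold σ x) = fold σ (w.1 x) := by
  rw [hat, wordMap, prod_sHat_fold hC, prod_redWord]

theorem hat_prod (hs : C.Signed) (l : List (Orbits σ)) :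
    hat hC hσ (l.map (dualFold hC hσ).s).prod = (l.map (sHat hσ)).prod :=
  eq_of_fold hs hσ (weylAut_hat hC hσ _) (weylAut_prod_sHat hσ l) fun x => by
    rw [hat_fold, prod_sHat_fold hC]

theorem hat_s (hs : C.Signed) (r : Orbits σ) : hat hC hσ ((dualFold hC hσ).s r) = sHat hσ r := by
  simpa using hat_prod hC hσ hs [r]

theorem hat_mul (hs : C.Signed) (u v : (dualFold hC hσ).weyl) :
    hat hC hσ (u * v) = hat hC hσ u * hat hC hσ v :=
  eq_of_fold hs hσ (weylAut_hat hC hσ _)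
    (by rw [map_mul, weylAut_hat, weylAut_hat]) fun x => by
      rw [mul_apply, hat_fold, hat_fold, hat_fold, mul_apply]

theorem hat_one (hs : C.Signed) : hat hC hσ 1 = 1 := by
  simpa using hat_prod hC hσ hs []

theorem hat_injective : Function.Injective (hat hC hσ) := fun u v h => by
  apply Subtype.ext
  apply LinearEquiv.ext
  intro x
  apply fold_injective
  rw [← hat_fold, h, hat_fold]

/-- An element fixed by the diagram automorphism is a product of elements `ŝ_r`: the left descents
of a fixed element form a union of orbits, so some `ŝ_r` can be split off. -/
theorem exists_hat_eq (hs : C.Signed) (n : ℕ) : ∀ w : C.weyl, len w = n → weylAut hσ w = w →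
    ∃ w', hat hC hσ w' = w := by
  induction n using Nat.strong_induction_on with
  | _ n ih =>
    intro w hn hw
    by_cases h1 : w = 1
    · exact ⟨1, by rw [hat_one hC hσ hs, h1]⟩
    obtain ⟨i, hi⟩ := exists_left_descent hs h1
    have hw' : weylAut hσ w⁻¹ = w⁻¹ := by rw [map_inv, hw]
    have hp := sHat_pre hs hσ (r := Orbits.mk σ i) fun j hj => nonpos_orbit hσ hw' hj.symm hi
    have hpos := length_orbitList_pos (Orbits.mk σ i)
    rw [Pre, len_sHat hs hσ] at hp
    obtain ⟨v, hv⟩ := ih _ (by omega) ((sHat hσ (Orbits.mk σ i))⁻¹ * w) rfl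
      (by rw [map_mul, map_inv, weylAut_sHat, hw])
    exact ⟨(dualFold hC hσ).s (Orbits.mk σ i) * v, by
      rw [hat_mul hC hσ hs, hat_s hC hσ hs, hv, mul_inv_cancel_left]⟩

theorem apply_single_nonneg_of_hat {w : (dualFold hC hσ).weyl} {i : ι}
    (h : 0 ≤ (hat hC hσ w).1 (Finsupp.single i 1)) :
    0 ≤ w.1 (Finsupp.single (Orbits.mk σ i) 1) := by
  rw [← fold_nonneg, ← hat_fold]
  exact apply_fold_nonneg hσ (weylAut_hat hC hσ w) h

theorem apply_single_nonpos_of_hat {w : (dualFold hC hσ).weyl} {i : ι}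
    (h : (hat hC hσ w).1 (Finsupp.single i 1) ≤ 0) :
    w.1 (Finsupp.single (Orbits.mk σ i) 1) ≤ 0 := by
  rw [← fold_nonpos, ← hat_fold]
  exact apply_fold_nonpos hσ (weylAut_hat hC hσ w) h

theorem signed_dualFold (hs : C.Signed) : (dualFold hC hσ).Signed := fun w r => by
  rw [← Orbits.mk_rep r]
  exact (hs (hat hC hσ w) (Orbits.rep σ r)).imp (apply_single_nonneg_of_hat hC hσ)
    (apply_single_nonpos_of_hat hC hσ)

theorem finite_weyl_dualFold [Finite C.weyl] : Finite (dualFold hC hσ).weyl :=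
  Finite.of_injective _ (hat_injective hC hσ)

theorem hat_apply_single_nonneg (hs : C.Signed) {w : (dualFold hC hσ).weyl} {i : ι}
    (h : 0 ≤ w.1 (Finsupp.single (Orbits.mk σ i) 1)) :
    0 ≤ (hat hC hσ w).1 (Finsupp.single i 1) :=
  (hs _ i).resolve_right fun h' =>
    not_apply_single_nonneg_and_nonpos w _ h (apply_single_nonpos_of_hat hC hσ h')

/-- The length of `ŵ` is computed from a reduced word of `w`. -/
theorem len_hat_prod (hs : C.Signed) (l : List (Orbits σ)) (hl : (dualFold hC hσ).Reduced l) :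
    len (hat hC hσ (l.map (dualFold hC hσ).s).prod) =
      (l.map fun r => (orbitList σ r).length).sum := by
  have hs' := signed_dualFold hC hσ hs
  induction l using List.reverseRecOn with
  | nil => simp [hat_one hC hσ hs]
  | append_singleton l r ih =>
    have hp : ((l ++ [r]).map (dualFold hC hσ).s).prod =
        (l.map (dualFold hC hσ).s).prod * (dualFold hC hσ).s r := by simp
    rw [Reduced, hp, List.length_append, List.length_singleton] at hl
    have h1 := len_le (C := dualFold hC hσ) _ l rfl
    have h2 := len_mul_le (l.map (dualFold hC hσ).s).prod ((dualFold hC hσ).s r)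
    have h3 := len_s_le (C := dualFold hC hσ) r
    have hpos := (nonneg_iff_len hs' (w := (l.map (dualFold hC hσ).s).prod) (i := r)).2 (by omega)
    rw [hp, hat_mul hC hσ hs, hat_s hC hσ hs, sHat_eq,
      (orthogonal_orbitList hσ r).len_mul_of_nonneg hs, ih (show l.length = _ by omega)]
    · simp
    · intro i hi
      apply hat_apply_single_nonneg hC hσ hs
      rwa [mem_orbitList.1 hi]

theorem len_hat_mul (hs : C.Signed) {u v : (dualFold hC hσ).weyl}
    (h : len (u * v) = len u + len v) :
    len (hat hC hσ u * hat hC hσ v) = len (hat hC hσ u) + len (hat hC hσ v) := by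
  have hp : ((redWord u ++ redWord v).map (dualFold hC hσ).s).prod = u * v := by
    rw [List.map_append, List.prod_append, prod_redWord, prod_redWord]
  have h1 := len_hat_prod hC hσ hs (redWord u ++ redWord v)
    (by rw [Reduced, hp, h, List.length_append, length_redWord, length_redWord])
  have h2 := len_hat_prod hC hσ hs _ (reduced_redWord u)
  have h3 := len_hat_prod hC hσ hs _ (reduced_redWord v)
  rw [hp, List.map_append, List.sum_append] at h1
  rw [prod_redWord] at h2 h3
  rw [← hat_mul hC hσ hs, h1, h2, h3]

/-- The isomorphism from the Weyl group of the dual of the folded Cartan matrix to the group of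
fixed points. -/
noncomputable def weylFold (hs : C.Signed) :
    (dualFold hC hσ).weyl ≃* fixedSubgroup (weylAut hσ) :=
  MulEquiv.ofBijective
    (MonoidHom.mk' (fun w => (⟨hat hC hσ w, weylAut_hat hC hσ w⟩ : fixedSubgroup (weylAut hσ)))
      fun u v => Subtype.ext (hat_mul hC hσ hs u v))
    ⟨fun _ _ h => hat_injective hC hσ (congrArg Subtype.val h), fun w =>
      let ⟨w', h⟩ := exists_hat_eq hC hσ hs _ w.1 rfl w.2
      ⟨w', Subtype.ext h⟩⟩

/-! ### The diagram automorphism on positive braids -/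

theorem isBraided_pos_perm (hσ : C.IsAdmissible σ) : C.IsBraided fun i => C.pos (σ i) :=
  fun i j => by rw [← m_map hσ]; exact C.isBraided_pos _ _

/-- The endomorphism of the monoid of positive braids given by the diagram automorphism. -/
noncomputable def posHom : C.BraidMonoid →* C.BraidMonoid := posLift _ (isBraided_pos_perm hσ)

theorem posHom_pos (i : ι) : posHom hσ (C.pos i) = C.pos (σ i) := posLift_pos ..

theorem posHom_simple (hs : C.Signed) (w : C.weyl) :
    posHom hσ (simple w) = simple (weylAut hσ w) := by
  rw [simple, map_wordMap, ← wordMap_eq_of_mul hs (g := fun w => simple (weylAut hσ w))]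
  · refine congrArg (wordMap · w) (funext fun i => ?_)
    rw [Function.comp_apply, posHom_pos, weylAut_s, simple_s hs]
  · rw [map_one, simple_one]
  · intro u v h
    rw [map_mul, simple_mul hs]
    rw [← map_mul, len_weylAut, len_weylAut, len_weylAut, h]

theorem toBraid_posHom (b : C.BraidMonoid) :
    C.toBraid (posHom hσ b) = braidAut hσ (C.toBraid b) := by
  have : C.toBraid.comp (posHom hσ) = (braidAut hσ).toMonoidHom.comp C.toBraid :=
    hom_ext fun i => by
      change C.toBraid (posHom hσ (C.pos i)) = braidAut hσ (C.toBraid (C.pos i))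
      rw [posHom_pos, toBraid_pos, toBraid_pos, braidAut_T]
  exact DFunLike.congr_fun this b

theorem deg_simple (w : C.weyl) : (deg (simple w)).toAdd = len w := by
  have : ∀ l : List ι, (deg (l.map C.pos).prod).toAdd = l.length := fun l => by
    induction l with
    | nil => rw [List.map_nil, List.prod_nil, map_one]; rfl
    | cons i l ih => rw [List.map_cons, List.prod_cons, deg_pos_mul, ih, List.length_cons]
  exact this (redWord w)

theorem pos_cases (b : C.BraidMonoid) : b = 1 ∨ ∃ i c, b = C.pos i * c := by
  induction b using pos_induction with
  | one => exact Or.inl rfl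
  | pos_mul i b _ => exact Or.inr ⟨i, b, rfl⟩

theorem left_descent_of_pos_mul (hs : C.Signed) (i : ι) (c : C.BraidMonoid) :
    ((nf hs (C.pos i * c)).1⁻¹).1 (Finsupp.single i 1) ≤ 0 := by
  have h := pre_nf_of_simple_mul hs (C.s i) c
  rw [simple_s hs] at h
  rw [Pre, s_inv, len_s hs, len_s_mul] at h
  rw [nonpos_iff_len hs, len_inv]
  omega

/-- A positive braid fixed by the diagram automorphism that is divisible by `T_i` is divisible by
the product over the orbit of `i`, with a fixed quotient. -/
theorem exists_eq_simple_sHat_mul (hs : C.Signed) {b c : C.BraidMonoid} {i : ι}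
    (hb : posHom hσ b = b) (h : b = C.pos i * c) :
    ∃ d, b = simple (sHat hσ (Orbits.mk σ i)) * d ∧ posHom hσ d = d := by
  have hdiv : ∀ j, Orbits.mk σ j = Orbits.mk σ i →
      ((nf hs b).1⁻¹).1 (Finsupp.single j 1) ≤ 0 := fun j hj => by
    obtain ⟨c', hc'⟩ : ∃ c', b = C.pos j * c' :=
      orbit_induction (p := fun j => ∃ c', b = C.pos j * c')
        (fun k ⟨c', hk⟩ => ⟨posHom hσ c', by rw [← posHom_pos hσ, ← map_mul, ← hk, hb]⟩)
        hj.symm ⟨c, h⟩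
    rw [hc']
    exact left_descent_of_pos_mul hs j c'
  have hp := sHat_pre hs hσ hdiv
  have hbd : b = simple (sHat hσ (Orbits.mk σ i)) *
      (simple ((sHat hσ (Orbits.mk σ i))⁻¹ * (nf hs b).1) * (nf hs b).2) := by
    rw [← mul_assoc, ← simple_mul hs, mul_inv_cancel_left, simple_nf]
    rw [mul_inv_cancel_left]
    exact hp
  refine ⟨_, hbd, simple_mul_left_cancel hs (u := sHat hσ (Orbits.mk σ i)) ?_⟩
  conv_lhs => rw [← weylAut_sHat hσ, ← posHom_simple hσ hs, ← map_mul]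
  rw [weylAut_sHat, ← hbd, hb]

/-! ### The isomorphism of braid monoids -/

theorem isBraided_simple_hat (hs : C.Signed) : (dualFold hC hσ).IsBraided fun r =>
    simple (hat hC hσ ((dualFold hC hσ).s r)) :=
  isBraided_of_mul (signed_dualFold hC hσ hs) (g := fun w => simple (hat hC hσ w))
    (by rw [hat_one hC hσ hs, simple_one]) fun u v h => by
      rw [hat_mul hC hσ hs, simple_mul hs (len_hat_mul hC hσ hs h)]

/-- The homomorphism of monoids of positive braids with `T_w ↦ T_ŵ`. -/
noncomputable def posFold (hs : C.Signed) : (dualFold hC hσ).BraidMonoid →* C.BraidMonoid :=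
  posLift _ (isBraided_simple_hat hC hσ hs)

theorem posFold_pos (hs : C.Signed) (r : Orbits σ) :
    posFold hC hσ hs ((dualFold hC hσ).pos r) = simple (sHat hσ r) := by
  rw [posFold, posLift_pos, hat_s hC hσ hs]

theorem posFold_simple (hs : C.Signed) (w : (dualFold hC hσ).weyl) :
    posFold hC hσ hs (simple w) = simple (hat hC hσ w) := by
  rw [simple, map_wordMap, ← wordMap_eq_of_mul (signed_dualFold hC hσ hs)
    (g := fun w => simple (hat hC hσ w)) (by rw [hat_one hC hσ hs, simple_one])
    fun u v h => by rw [hat_mul hC hσ hs, simple_mul hs (len_hat_mul hC hσ hs h)]]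
  refine congrArg (wordMap · w) (funext fun r => ?_)
  rw [Function.comp_apply, posFold_pos, hat_s hC hσ hs]

theorem posHom_posFold (hs : C.Signed) (b : (dualFold hC hσ).BraidMonoid) :
    posHom hσ (posFold hC hσ hs b) = posFold hC hσ hs b := by
  have : (posHom hσ).comp (posFold hC hσ hs) = posFold hC hσ hs := hom_ext fun r => by
    rw [MonoidHom.comp_apply, posFold_pos, posHom_simple hσ hs, weylAut_sHat]
  exact DFunLike.congr_fun this b

theorem exists_posFold_eq (hs : C.Signed) (n : ℕ) : ∀ b : C.BraidMonoid, (deg b).toAdd = n →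
    posHom hσ b = b → ∃ b', posFold hC hσ hs b' = b := by
  induction n using Nat.strong_induction_on with
  | _ n ih =>
    intro b hn hb
    rcases pos_cases b with rfl | ⟨i, c, hc⟩
    · exact ⟨1, map_one _⟩
    obtain ⟨d, hd, hσd⟩ := exists_eq_simple_sHat_mul hσ hs hb hc
    have hpos := length_orbitList_pos (Orbits.mk σ i)
    have hdeg := congrArg (fun b => (deg b).toAdd) hd
    rw [map_mul, toAdd_mul, deg_simple, len_sHat hs hσ, hn] at hdeg
    obtain ⟨d', hd'⟩ := ih _ (by omega) d rfl hσd
    exact ⟨(dualFold hC hσ).pos (Orbits.mk σ i) * d', by rw [map_mul, posFold_pos, hd', hd]⟩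

theorem posFold_pos_mul_ne_one (hs : C.Signed) (r : Orbits σ)
    (c : (dualFold hC hσ).BraidMonoid) :
    posFold hC hσ hs ((dualFold hC hσ).pos r * c) ≠ 1 := fun h => by
  have hdeg := congrArg (fun b => (deg b).toAdd) h
  have hpos := length_orbitList_pos r
  rw [map_mul, map_mul, toAdd_mul, posFold_pos, deg_simple, len_sHat hs hσ, map_one,
    toAdd_one] at hdeg
  omega

/-- The greatest simple left divisor of a fixed positive braid is fixed. -/
theorem weylAut_nf (hs : C.Signed) {b : C.BraidMonoid} (hb : posHom hσ b = b) :
    weylAut hσ (nf hs b).1 = (nf hs b).1 := by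
  have h : simple (weylAut hσ (nf hs b).1) * posHom hσ (nf hs b).2 = b := by
    rw [← posHom_simple hσ hs, ← map_mul, simple_nf, hb]
  have hp := pre_nf_of_simple_mul hs (weylAut hσ (nf hs b).1) (posHom hσ (nf hs b).2)
  rw [h] at hp
  exact hp.eq_of_len_le (len_weylAut hσ _).ge

theorem left_descent_of_sHat_pre (hs : C.Signed) {w' : (dualFold hC hσ).weyl} {r : Orbits σ}
    (h : Pre (sHat hσ r) (hat hC hσ w')) : (w'⁻¹).1 (Finsupp.single r 1) ≤ 0 := by
  have hs' := signed_dualFold hC hσ hs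
  refine (hs' w'⁻¹ r).resolve_left fun h0 => ?_
  have h1 := len_mul_s_of_nonneg hs' h0
  rw [← len_s_mul, len_inv] at h1
  have h2 := len_hat_mul hC hσ hs (u := (dualFold hC hσ).s r) (v := w')
    (by rw [h1, len_s hs', add_comm])
  have h3 : (sHat hσ r)⁻¹ = sHat hσ r := by
    apply inv_eq_of_mul_eq_one_left
    rw [← hat_s hC hσ hs, ← hat_mul hC hσ hs, s_mul_self, hat_one hC hσ hs]
  rw [hat_s hC hσ hs] at h2
  rw [Pre, h3] at h
  have := len_sHat hs hσ r
  have := length_orbitList_pos r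
  omega

/-- The homomorphism of braid monoids is injective because it preserves least common multiples: if
the image of `b₁ = T_r c₁` and `b₂ = T_t c₂` is divisible by the images of `T_r` and `T_t`, it is
divisible by the image of the longest alternating word in `T_r`, `T_t`, with a fixed quotient. -/
theorem posFold_injective_of_deg_eq (hs : C.Signed) (n : ℕ) :
    ∀ b₁ b₂ : (dualFold hC hσ).BraidMonoid, (deg b₁).toAdd = n →
      posFold hC hσ hs b₁ = posFold hC hσ hs b₂ → b₁ = b₂ := by
  have hs' := signed_dualFold hC hσ hs
  induction n with
  | zero =>
    intro b₁ b₂ hn h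
    rcases pos_cases b₁ with rfl | ⟨r, c₁, rfl⟩
    · rcases pos_cases b₂ with rfl | ⟨t, c₂, rfl⟩
      · rfl
      · rw [map_one] at h
        exact absurd h.symm (posFold_pos_mul_ne_one hC hσ hs t c₂)
    · rw [deg_pos_mul] at hn
      omega
  | succ n ih =>
    intro b₁ b₂ hn h
    rcases pos_cases b₁ with rfl | ⟨r, c₁, rfl⟩
    · rw [map_one, toAdd_one] at hn
      omega
    rcases pos_cases b₂ with rfl | ⟨t, c₂, rfl⟩
    · rw [map_one] at h
      exact absurd h (posFold_pos_mul_ne_one hC hσ hs r c₁)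
    rw [deg_pos_mul] at hn
    rcases eq_or_ne r t with rfl | hrt
    · rw [map_mul, map_mul] at h
      rw [ih c₁ c₂ (by omega) (pos_mul_left_cancel hs h)]
    set x := posFold hC hσ hs ((dualFold hC hσ).pos r * c₁) with hx
    have hxσ : posHom hσ x = x := posHom_posFold hC hσ hs _
    obtain ⟨w', hw'⟩ := exists_hat_eq hC hσ hs _ _ rfl (weylAut_nf hσ hs hxσ)
    have hr : (w'⁻¹).1 (Finsupp.single r 1) ≤ 0 := by
      apply left_descent_of_sHat_pre hC hσ hs
      rw [hw', hx, map_mul, posFold_pos]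
      exact pre_nf_of_simple_mul hs _ _
    have ht : (w'⁻¹).1 (Finsupp.single t 1) ≤ 0 := by
      apply left_descent_of_sHat_pre hC hσ hs
      rw [hw', h, map_mul, posFold_pos]
      exact pre_nf_of_simple_mul hs _ _
    have hlen := len_alt_inv_mul hs' hrt hr ht
    set a := alt ((dualFold hC hσ).s r) ((dualFold hC hσ).s t) ((dualFold hC hσ).m r t) with ha
    have hxa : x = posFold hC hσ hs (simple a) * (simple (hat hC hσ (a⁻¹ * w')) * (nf hs x).2) := by
      rw [posFold_simple, ← mul_assoc, ← simple_mul hs, ← hat_mul hC hσ hs, mul_inv_cancel_left,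
        hw', simple_nf]
      refine len_hat_mul hC hσ hs ?_
      rw [mul_inv_cancel_left, ← hlen, ha, len_alt hs' hrt le_rfl, add_comm]
    obtain ⟨d, hd⟩ := exists_posFold_eq hC hσ hs _
      (simple (hat hC hσ (a⁻¹ * w')) * (nf hs x).2) rfl (by
        apply pos_mul_left_cancel hs (a := posFold hC hσ hs (simple a))
        conv_lhs => rw [← posHom_posFold, ← map_mul, ← hxa]
        rw [← hxa, hxσ])
    obtain ⟨k, hk⟩ : ∃ k, (dualFold hC hσ).m r t = k + 1 :=
      ⟨(dualFold hC hσ).m r t - 1, by have := two_le_m (C := dualFold hC hσ) hrt; omega⟩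
    have hsa : simple a = alt ((dualFold hC hσ).pos r) ((dualFold hC hσ).pos t)
        ((dualFold hC hσ).m r t) := wordMap_alt hs' (isBraided_pos _) hrt le_rfl
    have h1 : simple a = (dualFold hC hσ).pos r *
        alt ((dualFold hC hσ).pos t) ((dualFold hC hσ).pos r) k := by rw [hsa, hk, alt]
    have h2 : simple a = (dualFold hC hσ).pos t *
        alt ((dualFold hC hσ).pos r) ((dualFold hC hσ).pos t) k := by
      rw [hsa, isBraided_pos, hk, alt]
    rw [← hd, ← map_mul] at hxa
    have e1 : (dualFold hC hσ).pos r * c₁ = simple a * d := by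
      rw [h1, mul_assoc]
      congr 1
      refine ih _ _ (by omega) ?_
      apply pos_mul_left_cancel hs (a := posFold hC hσ hs ((dualFold hC hσ).pos r))
      rw [← map_mul, ← map_mul, ← mul_assoc, ← h1, ← hxa]
    have e2 : simple a * d = (dualFold hC hσ).pos t * c₂ := by
      have hdeg := congrArg (fun b => (deg b).toAdd) e1
      rw [h2, mul_assoc, deg_pos_mul, deg_pos_mul] at hdeg
      rw [h2, mul_assoc]
      congr 1
      refine ih _ _ (by omega) ?_
      apply pos_mul_left_cancel hs (a := posFold hC hσ hs ((dualFold hC hσ).pos t))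
      rw [← map_mul, ← map_mul, ← mul_assoc, ← h2, ← hxa, h]
    exact e1.trans e2

theorem posFold_injective (hs : C.Signed) : Function.Injective (posFold hC hσ hs) :=
  fun b₁ b₂ h => posFold_injective_of_deg_eq hC hσ hs _ b₁ b₂ rfl h

/-! ### The isomorphism of braid groups -/

theorem isBraided_THat (hs : C.Signed) : (dualFold hC hσ).IsBraided (THat hσ) := fun r t => by
  have e : ∀ r, THat hσ r = C.toBraid (simple (hat hC hσ ((dualFold hC hσ).s r))) := fun r => by
    rw [THat_eq hs, toBraid_simple, hat_s hC hσ hs]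
  rw [e, e, ← map_alt, isBraided_simple_hat hC hσ hs r t, map_alt]

/-- The homomorphism of braid groups with `T_r ↦ T̂_r`. -/
noncomputable def braidFoldHom (hs : C.Signed) : (dualFold hC hσ).Braid →* C.Braid :=
  braidLift (THat hσ) (isBraided_THat hC hσ hs)

theorem braidFoldHom_toBraid (hs : C.Signed) (b : (dualFold hC hσ).BraidMonoid) :
    braidFoldHom hC hσ hs ((dualFold hC hσ).toBraid b) = C.toBraid (posFold hC hσ hs b) := by
  have : (braidFoldHom hC hσ hs).comp (dualFold hC hσ).toBraid =
      C.toBraid.comp (posFold hC hσ hs) := hom_ext fun r => by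
    rw [MonoidHom.comp_apply, MonoidHom.comp_apply, toBraid_pos, braidFoldHom, braidLift_T,
      posFold_pos, toBraid_simple, THat_eq hs]
  exact DFunLike.congr_fun this b

theorem braidAut_THat (hs : C.Signed) (r : Orbits σ) : braidAut hσ (THat hσ r) = THat hσ r := by
  rw [THat_eq hs, ← toBraid_simple, ← toBraid_posHom, posHom_simple hσ hs, weylAut_sHat]

theorem braidAut_braidFoldHom (hs : C.Signed) (x : (dualFold hC hσ).Braid) :
    braidAut hσ (braidFoldHom hC hσ hs x) = braidFoldHom hC hσ hs x := by
  have : (braidAut hσ).toMonoidHom.comp (braidFoldHom hC hσ hs) = braidFoldHom hC hσ hs :=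
    PresentedGroup.ext fun r => by
      change braidAut hσ (braidLift _ _ ((dualFold hC hσ).T r)) =
        braidLift _ _ ((dualFold hC hσ).T r)
      rw [braidLift_T, braidAut_THat hσ hs]
  exact DFunLike.congr_fun this x

theorem braidFoldHom_injective (hs : C.Signed) [Finite C.weyl] :
    Function.Injective (braidFoldHom hC hσ hs) := by
  have hs' := signed_dualFold hC hσ hs
  have := finite_weyl_dualFold hC hσ
  obtain ⟨w₀, h₀⟩ := exists_longest hs'
  rw [injective_iff_map_eq_one]
  intro x hx
  obtain ⟨k, b, hb⟩ := exists_pow_mul_eq hs' h₀ x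
  have h := congrArg (braidFoldHom hC hσ hs) hb
  rw [map_mul, hx, mul_one, ← map_pow, braidFoldHom_toBraid, braidFoldHom_toBraid] at h
  rw [← posFold_injective hC hσ hs (toBraid_injective hs h), map_pow, mul_eq_left] at hb
  exact hb

theorem exists_braidFoldHom_eq (hs : C.Signed) [Finite C.weyl] {x : C.Braid}
    (hx : braidAut hσ x = x) : ∃ y, braidFoldHom hC hσ hs y = x := by
  obtain ⟨w₀, h₀⟩ := exists_longest hs
  have hw₀ : weylAut hσ w₀ = w₀ := by
    have h1 := h₀ (weylAut hσ w₀)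
    rw [len_weylAut] at h1
    have h2 := eq_one_of_len_eq_zero (w := w₀ * weylAut hσ w₀) (by omega)
    rw [← longest_mul_self h₀] at h2
    exact mul_left_cancel h2
  have hz : posHom hσ (simple w₀ * simple w₀) = simple w₀ * simple w₀ := by
    rw [map_mul, posHom_simple hσ hs, hw₀]
  obtain ⟨k, b, hb⟩ := exists_pow_mul_eq hs h₀ x
  have hbσ : posHom hσ b = b := by
    apply toBraid_injective hs
    rw [toBraid_posHom, ← hb, map_mul, map_pow, hx, ← toBraid_posHom, hz]
  obtain ⟨z', hz'⟩ := exists_posFold_eq hC hσ hs _ _ rfl hz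
  obtain ⟨b', hb'⟩ := exists_posFold_eq hC hσ hs _ _ rfl hbσ
  refine ⟨((dualFold hC hσ).toBraid z' ^ k)⁻¹ * (dualFold hC hσ).toBraid b', ?_⟩
  rw [map_mul, map_inv, map_pow, braidFoldHom_toBraid, braidFoldHom_toBraid, hz', hb', ← hb,
    inv_mul_cancel_left]

/-- The isomorphism from the braid group of the dual of the folded Cartan matrix to the group of
fixed points. -/
noncomputable def braidFold (hs : C.Signed) [Finite C.weyl] :
    (dualFold hC hσ).Braid ≃* fixedSubgroup (braidAut hσ) :=
  MulEquiv.ofBijective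
    ((braidFoldHom hC hσ hs).codRestrict _ (braidAut_braidFoldHom hC hσ hs))
    ⟨fun _ _ h => braidFoldHom_injective hC hσ hs (congrArg Subtype.val h), fun x =>
      let ⟨y, h⟩ := exists_braidFoldHom_eq hC hσ hs x.2
      ⟨y, Subtype.ext h⟩⟩

theorem reduced_of_isReducedWord {ι : Type*} [Fintype ι] {C : FiniteCartan ι} {w : C.weyl}
    {l : List ι} (h : C.IsReducedWord w l) : C.Reduced l := by
  obtain ⟨rfl, h⟩ := isReducedWord_iff.1 h
  exact h

theorem braidFoldHom_prod (hs : C.Signed) {w : (dualFold hC hσ).weyl} {l : List (Orbits σ)}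
    {l' : List ι} (hl : (dualFold hC hσ).IsReducedWord w l)
    (hl' : C.IsReducedWord (hat hC hσ w) l') :
    braidFoldHom hC hσ hs (l.map (dualFold hC hσ).T).prod = (l'.map C.T).prod := by
  rw [prod_map_eq_wordMap (signed_dualFold hC hσ hs) (isBraided_T _) (reduced_of_isReducedWord hl),
    hl.1, prod_map_eq_wordMap hs C.isBraided_T (reduced_of_isReducedWord hl'), hl'.1,
    ← toBraid_simple, ← toBraid_simple, braidFoldHom_toBraid, posFold_simple]

end hat

end FiniteCartan

namespace FiniteCartan

/-! ### Signs of roots from a base of a root system -/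

section RootPairing

variable {κ R M N : Type*} [Field R] [AddCommGroup M] [Module R M]
  [AddCommGroup N] [Module R N] {P : RootPairing κ R M N} (b : P.Base)

/-- The root lattice, as a lattice in the ambient space of the root system. -/
noncomputable def rootMap : (b.support →₀ ℤ) →ₗ[ℤ] M :=
  Finsupp.linearCombination ℤ fun i : b.support => P.root i

theorem rootMap_single (i : b.support) : rootMap b (Finsupp.single i 1) = P.root i := by
  simp [rootMap]

theorem rootMap_injective [CharZero R] : Function.Injective (rootMap b) :=
  b.linearIndepOn_root.restrict_scalars' ℤ

theorem exists_nonneg_of_mem_closure {x : M}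
    (hx : x ∈ AddSubmonoid.closure (P.root '' b.support)) : ∃ v, 0 ≤ v ∧ rootMap b v = x := by
  induction hx using AddSubmonoid.closure_induction with
  | mem x hx =>
    obtain ⟨i, hi, rfl⟩ := hx
    exact ⟨Finsupp.single ⟨i, hi⟩ 1, by simp, rootMap_single b ⟨i, hi⟩⟩
  | zero => exact ⟨0, le_rfl, map_zero _⟩
  | add x y _ _ hx hy =>
    obtain ⟨u, hu, rfl⟩ := hx
    obtain ⟨v, hv, rfl⟩ := hy
    exact ⟨u + v, add_nonneg hu hv, map_add _ _ _⟩

variable {b} {C : FiniteCartan b.support}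

theorem rootMap_reflection (hA : ∀ i j, (C.A i j : R) = P.pairing j i) (i : b.support)
    (v : b.support →₀ ℤ) : rootMap b (C.reflection i v) = P.reflection i (rootMap b v) := by
  induction v using Finsupp.induction_linear with
  | zero => simp
  | add u v hu hv => rw [map_add, map_add, hu, hv, map_add, map_add]
  | single j c =>
    rw [← mul_one c, ← smul_eq_mul, ← Finsupp.smul_single, map_zsmul, map_zsmul, map_zsmul,
      map_zsmul, reflection_single, map_sub, map_zsmul, rootMap_single, rootMap_single,
      RootPairing.reflection_apply_root, ← hA, Int.cast_smul_eq_zsmul]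

theorem exists_rootMap_eq_root (hA : ∀ i j, (C.A i j : R) = P.pairing j i) (w : C.weyl)
    (i : b.support) : ∃ k, rootMap b (w.1 (Finsupp.single i 1)) = P.root k := by
  rw [← prod_redWord w]
  induction redWord w with
  | nil => exact ⟨i, rootMap_single b i⟩
  | cons j l ih =>
    obtain ⟨k, hk⟩ := ih
    refine ⟨P.reflectionPerm j k, ?_⟩
    rw [List.map_cons, List.prod_cons, mul_apply, P.root_reflectionPerm, ← hk]
    exact rootMap_reflection hA j _

theorem signed_of_base [CharZero R] (hA : ∀ i j, (C.A i j : R) = P.pairing j i) :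
    C.Signed := fun w i => by
  obtain ⟨k, hk⟩ := exists_rootMap_eq_root hA w i
  rcases b.root_mem_or_neg_mem k with h | h
  · obtain ⟨v, hv, he⟩ := exists_nonneg_of_mem_closure b h
    left
    rwa [rootMap_injective b (hk.trans he.symm)]
  · obtain ⟨v, hv, he⟩ := exists_nonneg_of_mem_closure b h
    right
    have : w.1 (Finsupp.single i 1) = -v := rootMap_injective b (by rw [hk, map_neg, he, neg_neg])
    rw [this]
    exact neg_nonpos.2 hv

theorem finite_weyl_of_base [CharZero R] [Finite κ] (hA : ∀ i j, (C.A i j : R) = P.pairing j i) :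
    Finite C.weyl := by
  choose k hk using fun (w : C.weyl) (i : b.support) => exists_rootMap_eq_root hA w i
  refine Finite.of_injective k fun u v h => ?_
  apply Subtype.ext
  apply LinearEquiv.toLinearMap_injective
  ext1 i
  ext1
  apply rootMap_injective b
  change rootMap b (u.1 (Finsupp.single i 1)) = rootMap b (v.1 (Finsupp.single i 1))
  rw [hk, hk, h]

end RootPairing

theorem ofBase_apply {𝔤 : Type*} [LieRing 𝔤] [LieAlgebra ℂ 𝔤] [FiniteDimensional ℂ 𝔤]
    [LieAlgebra.IsSemisimple ℂ 𝔤] {H : LieSubalgebra ℂ 𝔤} [H.IsCartanSubalgebra]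
    (b : (LieAlgebra.IsKilling.rootSystem H).Base) (i j : b.support) :
    ((ofBase b).A i j : ℂ) = (LieAlgebra.IsKilling.rootSystem H).pairing j i :=
  b.algebraMap_cartanMatrixIn_apply ℤ j i

end FiniteCartan

/-- Folding of Weyl groups and braid groups. The element `T_w` of a braid group is the product
`T_{i_1} ⋯ T_{i_m}` for each reduced decomposition `(i_1, …, i_m)` of `w`. -/
theorem proposition2p4 {𝔤 : Type*} [LieRing 𝔤] [LieAlgebra ℂ 𝔤] [FiniteDimensional ℂ 𝔤]
    [LieAlgebra.IsSemisimple ℂ 𝔤] (H : LieSubalgebra ℂ 𝔤) [H.IsCartanSubalgebra]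
    (b : (LieAlgebra.IsKilling.rootSystem H).Base)
    (C : FiniteCartan b.support) (hb : C = FiniteCartan.ofBase b)
    (hC : C.A.IsSimplyLaced)
    (σ : Equiv.Perm b.support) (hσ : C.IsAdmissible σ)
    (C' : FiniteCartan (Orbits σ)) (hC' : C' = FiniteCartan.dualFold hC hσ) :
    ∃ φ : C'.weyl ≃* FiniteCartan.fixedSubgroup (FiniteCartan.weylAut hσ),
      (∀ r, (φ (C'.s r) : C.weyl) = FiniteCartan.sHat hσ r) ∧
      ∃ Φ : C'.Braid ≃* FiniteCartan.fixedSubgroup (FiniteCartan.braidAut hσ),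
        (∀ r, (Φ (C'.T r) : C.Braid) = FiniteCartan.THat hσ r) ∧
        ∀ (w : C'.weyl) (l : List (Orbits σ)) (l' : List b.support),
          C'.IsReducedWord w l → C.IsReducedWord (φ w : C.weyl) l' →
            (Φ (l.map C'.T).prod : C.Braid) = (l'.map C.T).prod := by
  subst hC'
  have hA : ∀ i j, (C.A i j : ℂ) = (LieAlgebra.IsKilling.rootSystem H).pairing j i := by
    rw [hb]; exact FiniteCartan.ofBase_apply b
  have hs : C.Signed := FiniteCartan.signed_of_base hA
  have : Finite C.weyl := FiniteCartan.finite_weyl_of_base hA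
  exact ⟨FiniteCartan.weylFold hC hσ hs, FiniteCartan.hat_s hC hσ hs,
    FiniteCartan.braidFold hC hσ hs, fun r => FiniteCartan.braidLift_T _ _ r,
    fun w l l' hl hl' => FiniteCartan.braidFoldHom_prod hC hσ hs hl hl'⟩
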